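/- Let $G$ be a finite group, let $H$ be a nonzero finite-dimensional complex Hilbert space, and let $(U_g)_{g\in G}$ be unitaries on $H$ forming a projective representation: $U_gU_h=c(g,h)\,U_{gh}$ with $|c(g,h)|=1$, and $U_e=\mathbb 1$ (a linear unitary representation is the case $c=1$). Let $\psi\in H$ be a unit vector, $|\psi_g\rangle=U_g|\psi\rangle$ with equal prior probabilities $1/|G|$, and $\Omega=\sum_{g\in G}|\psi_g\rangle\langle\psi_g|$. Let $\alpha_1\ge\alpha_2\ge\dots\ge\alpha_{\dim H}\ge 0$ be the eigenvalues of $\Omega$ repeated according to multiplicity, put $\beta_i=\sqrt{\alpha_i/|G|}$ and $\Delta=\sum_{i\ge 2}\beta_i$, and assume $\beta_1>\Delta$ (the region in which perfect exclusion is not possible). Put $Q^{\mathrm{prim}}=\beta_1^2-\Delta^2$. Then: 1. $Q^{\mathrm{prim}}$ is the minimum $Q^*$ of the inconclusive probability $\frac1{|G|}\sum_g\langle\psi_g|(\mathbb 1-\sum_h\Pi_h)|\psi_g\rangle$ over all families $(\Pi_g)_{g\in G}$ with $\Pi_g\ge0$, $\mathbb 1-\sum_g\Pi_g\ge0$ and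 $\langle\psi_g|\Pi_g|\psi_g\rangle=0$ for all $g$. 2. $Q^{\mathrm{prim}}$ is also the minimum of the covariant program: minimize $1-\operatorname{Tr}(\Omega E)$ over $E\ge0$ with $\mathbb 1-\sum_gU_gEU_g^\dagger\ge0$ and $\langle\psi|E|\psi\rangle=0$. 3. Call $(X,\nu)$, with $X\ge0$ an operator on $H$ and $\nu\in\mathbb R$, dual feasible if $\sum_gU_gXU_g^\dagger+\nu|\psi\rangle\langle\psi|-\Omega\ge0$. Then $1-\operatorname{Tr}X\le Q^{\mathrm{prim}}$ for every dual feasible $(X,\nu)$, and for every $\varepsilon>0$ there is a dual feasible $(X,\nu)$ with $1-\operatorname{Tr}X=Q^{\mathrm{prim}}-\varepsilon$. 4. Let $U_g\cong\bigoplus_\mu U^\mu_g\otimes\mathbb 1_{m_\mu}$ be any decomposition into pairwise inequivalent irreducible unitary projective representations $U^\mu$ with multiplier $c$, of dimension $d_\mu$ and multiplicity $m_\mu$, and let $\{|v^\mu_i\rangle\}_{i\le d_\mu}$, $\{|u^\mu_j\rangle\}_{j\le m_\mu}$ be orthonormal (Schmidt) bases such that $|\psi\rangle=\sum_\mu\sqrt{d_\mu}\sum_{k=1}^{r_\mu}\beta^\mu_k|\xi^\mu_k\rangle$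 with $\beta^\mu_k>0$ and $|\xi^\mu_k\rangle=|v^\mu_k\rangle|u^\mu_k\rangle$. Then $\Omega|v^\mu_i\rangle|u^\mu_k\rangle=|G|(\beta^\mu_k)^2|v^\mu_i\rangle|u^\mu_k\rangle$ for all $i\le d_\mu$, $k\le r_\mu$. Let $(\mu_1,k_1)$ be an index at which $\beta^\mu_k$ is largest. Then $d_{\mu_1}=r_{\mu_1}=1$, $\beta^{\mu_1}_{k_1}=\beta_1$ and $\sum_{\mu\ne\mu_1}\sum_{k=1}^{r_\mu}d_\mu\beta^\mu_k=\Delta$. With the seed vector $$|\omega\rangle=\frac1{\sqrt{|G|}}\Bigl(\frac{\Delta}{\beta_1}|\xi^{\mu_1}_{k_1}\rangle-\sum_{\mu\neq\mu_1}\sum_{k=1}^{r_\mu}\sqrt{d_\mu}\,|\xi^\mu_k\rangle\Bigr),$$ the operator $E=|\omega\rangle\langle\omega|$ is feasible in 2, the covariant family $\Pi_g=U_g|\omega\rangle\langle\omega|U_g^\dagger$ is feasible in 1, and both attain the value $Q^{\mathrm{prim}}$; so the seed is optimal. -/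

import Mathlib

open Module

noncomputable section

namespace StateExclusion

variable {G : Type*} [Group G] {H : Type*} [NormedAddCommGroup H] [InnerProductSpace ℂ H]

/-- `U` is a unitary projective representation of `G` on `H` with multiplier `c` (pure phases):
`U g U h = c(g,h) U (gh)` and `U 1 = 1`. Linear unitary representations are the case `c = 1`. -/
structure IsProjectiveUnitaryRep (U : G → H ≃ₗᵢ[ℂ] H) (c : G → G → ℂ) : Prop where
  norm_multiplier : ∀ g h, ‖c g h‖ = 1
  map_one : ∀ x, U 1 x = x
  map_mul : ∀ g h x, U g (U h x) = c g h • U (g * h) x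

/-- The operator `|x⟩⟨y|`. -/
def ketbra (x y : H) : H →ₗ[ℂ] H := (InnerProductSpace.rankOne ℂ x y : H →L[ℂ] H).toLinearMap

/-- Unitary conjugation `V E V†`. -/
def unitaryConj (V : H ≃ₗᵢ[ℂ] H) (E : H →ₗ[ℂ] H) : H →ₗ[ℂ] H :=
  V.toLinearEquiv.toLinearMap ∘ₗ E ∘ₗ V.symm.toLinearEquiv.toLinearMap

/-- Real part of the trace (the traces below are all real). -/
def reTrace (T : H →ₗ[ℂ] H) : ℝ := (LinearMap.trace ℂ H T).re

/-! ### The ensemble operator and its spectrum -/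

variable [Fintype G]

/-- The ensemble operator `Ω = ∑_g |ψ_g⟩⟨ψ_g|`, where `ψ_g = U_g ψ`. -/
def ensembleOp (U : G → H ≃ₗᵢ[ℂ] H) (ψ : H) : H →ₗ[ℂ] H :=
  ∑ g, ketbra (U g ψ) (U g ψ)

set_option linter.unusedSectionVars false in
theorem ensembleOp_isSymmetric (U : G → H ≃ₗᵢ[ℂ] H) (ψ : H) :
    (ensembleOp U ψ).IsSymmetric :=
  LinearMap.isSymmetric_sum _ fun _ _ => InnerProductSpace.isSymmetric_rankOne_self _

variable [FiniteDimensional ℂ H]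

/-- `β_i = √(α_i / |G|)`, where `α_0 ≥ α_1 ≥ …` are the eigenvalues of `Ω`, listed in decreasing
order and repeated according to multiplicity. -/
def specBeta (U : G → H ≃ₗᵢ[ℂ] H) (ψ : H) (i : Fin (finrank ℂ H)) : ℝ :=
  Real.sqrt ((ensembleOp_isSymmetric U ψ).eigenvalues rfl i / Fintype.card G)

/-- The value of `β` for the largest eigenvalue of `Ω`. -/
def specTop [Nontrivial H] (U : G → H ≃ₗᵢ[ℂ] H) (ψ : H) : ℝ :=
  specBeta U ψ ⟨0, finrank_pos⟩

/-- The sum of `β_i` over all eigenvalues of `Ω` other than the largest one (with multiplicity). -/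
def specDelta (U : G → H ≃ₗᵢ[ℂ] H) (ψ : H) : ℝ :=
  ∑ i : Fin (finrank ℂ H), if (i : ℕ) = 0 then 0 else specBeta U ψ i

/-- `Q^prim = β_1² - Δ²`. -/
def Qprim [Nontrivial H] (U : G → H ≃ₗᵢ[ℂ] H) (ψ : H) : ℝ :=
  specTop U ψ ^ 2 - specDelta U ψ ^ 2

/-! ### Unambiguous exclusion -/

/-- `(P g)` are the conclusive elements of a POVM (the inconclusive element is `1 - ∑ P g`),
and outcome `g` never occurs on the state `ψ_g`. -/
structure IsUnambiguousExclusion (U : G → H ≃ₗᵢ[ℂ] H) (ψ : H) (P : G → H →ₗ[ℂ] H) : Prop where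
  pos : ∀ g, (P g).IsPositive
  compl_pos : (1 - ∑ g, P g : H →ₗ[ℂ] H).IsPositive
  no_error : ∀ g, inner ℂ (U g ψ) (P g (U g ψ)) = 0

/-- Probability of the inconclusive outcome, each `ψ_g` having prior probability `1 / |G|`. -/
def inconclusiveProb (U : G → H ≃ₗᵢ[ℂ] H) (ψ : H) (P : G → H →ₗ[ℂ] H) : ℝ :=
  ∑ g, (1 / (Fintype.card G : ℝ)) *
    (inner ℂ (U g ψ) ((1 - ∑ h, P h : H →ₗ[ℂ] H) (U g ψ))).re

/-- Feasibility of a POVM seed `E` (with `P g = U_g E U_g†`) in the covariant primal program. -/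
structure PrimalFeasible (U : G → H ≃ₗᵢ[ℂ] H) (ψ : H) (E : H →ₗ[ℂ] H) : Prop where
  pos : E.IsPositive
  compl_pos : (1 - ∑ g, unitaryConj (U g) E : H →ₗ[ℂ] H).IsPositive
  no_error : inner ℂ ψ (E ψ) = 0

/-- Objective `1 - Tr(Ω E)` of the covariant primal program. -/
def primalValue (U : G → H ≃ₗᵢ[ℂ] H) (ψ : H) (E : H →ₗ[ℂ] H) : ℝ :=
  1 - reTrace (ensembleOp U ψ ∘ₗ E)

/-- Feasibility of `(X, ν)` in the dual program:
`X ≥ 0` and `∑_g U_g X U_g† + ν |ψ⟩⟨ψ| - Ω ≥ 0`. -/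
structure DualFeasible (U : G → H ≃ₗᵢ[ℂ] H) (ψ : H) (X : H →ₗ[ℂ] H) (ν : ℝ) : Prop where
  pos : X.IsPositive
  constraint :
    (∑ g, unitaryConj (U g) X + (ν : ℂ) • ketbra ψ ψ - ensembleOp U ψ).IsPositive

/-- Objective `1 - Tr X` of the dual program. -/
def dualValue (X : H →ₗ[ℂ] H) : ℝ := 1 - reTrace X

/-! ### Irreducible decomposition, Schmidt bases and the POVM seed -/

/-- A decomposition `U_g = ⨁_μ W^μ_g ⊗ 1_{m_μ}` of `U` into pairwise inequivalent irreducible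
unitary projective representations `W^μ` of dimension `d_μ` with the same multiplier `c`, together
with orthonormal bases `v^μ_i` of the representation spaces and `u^μ_j` of the multiplicity
spaces that are Schmidt bases of the isotypic components of `ψ`:
`ψ = ∑_μ √d_μ ∑_{k < r_μ} β^μ_k |v^μ_k⟩|u^μ_k⟩` with `β^μ_k > 0`.
Here `e ⟨μ, (i, j)⟩` is `|v^μ_i⟩|u^μ_j⟩` and `W μ g` is the matrix of `W^μ_g` in the basis
`v^μ`. -/
structure SchmidtDecomposition (U : G → H ≃ₗᵢ[ℂ] H) (c : G → G → ℂ) (ψ : H) where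
  /-- number of irreducible representations -/
  N : ℕ
  /-- dimensions -/
  d : Fin N → ℕ
  /-- multiplicities -/
  m : Fin N → ℕ
  /-- matrices of the irreducible representations -/
  W : (μ : Fin N) → G → Matrix (Fin (d μ)) (Fin (d μ)) ℂ
  W_unitary : ∀ μ g, W μ g ∈ Matrix.unitaryGroup (Fin (d μ)) ℂ
  W_one : ∀ μ, W μ 1 = 1
  W_mul : ∀ μ g h, W μ g * W μ h = c g h • W μ (g * h)
  d_pos : ∀ μ, 0 < d μ
  irreducible : ∀ μ (S : Submodule ℂ (Fin (d μ) → ℂ)),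
    (∀ g, ∀ x ∈ S, (W μ g).mulVec x ∈ S) → S = ⊥ ∨ S = ⊤
  inequivalent : ∀ μ ν, μ ≠ ν → ∀ T : (Fin (d μ) → ℂ) ≃ₗ[ℂ] (Fin (d ν) → ℂ),
    ¬ ∀ g x, T ((W μ g).mulVec x) = (W ν g).mulVec (T x)
  /-- the product basis -/
  e : OrthonormalBasis (Σ μ : Fin N, Fin (d μ) × Fin (m μ)) ℂ H
  map_e : ∀ g μ i j, U g (e ⟨μ, (i, j)⟩) = ∑ i', W μ g i' i • e ⟨μ, (i', j)⟩
  /-- Schmidt ranks -/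
  r : Fin N → ℕ
  r_le_d : ∀ μ, r μ ≤ d μ
  r_le_m : ∀ μ, r μ ≤ m μ
  /-- Schmidt coefficients -/
  β : (μ : Fin N) → Fin (r μ) → ℝ
  β_pos : ∀ μ k, 0 < β μ k
  schmidt : ψ = ∑ μ, ∑ k : Fin (r μ), ((Real.sqrt (d μ) * β μ k : ℝ) : ℂ) •
    e ⟨μ, (Fin.castLE (r_le_d μ) k, Fin.castLE (r_le_m μ) k)⟩

namespace SchmidtDecomposition

variable {U : G → H ≃ₗᵢ[ℂ] H} {c : G → G → ℂ} {ψ : H}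

/-- `|ξ^μ_k⟩ = |v^μ_k⟩|u^μ_k⟩`. -/
def ξ (D : SchmidtDecomposition U c ψ) (μ : Fin D.N) (k : Fin (D.r μ)) : H :=
  D.e ⟨μ, (Fin.castLE (D.r_le_d μ) k, Fin.castLE (D.r_le_m μ) k)⟩

/-- `Δ = ∑_{μ ≠ μ₁} ∑_k d_μ β^μ_k`. -/
def Δ (D : SchmidtDecomposition U c ψ) (μ₁ : Fin D.N) : ℝ :=
  ∑ μ, if μ = μ₁ then 0 else ∑ k, (D.d μ : ℝ) * D.β μ k

/-- The seed vector
`|G|^(-1/2) (γ |ξ^{μ₁}_{k₁}⟩ - ∑_{μ ≠ μ₁} ∑_k √d_μ |ξ^μ_k⟩)` with `γ = Δ / β^{μ₁}_{k₁}`. -/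
def seed (D : SchmidtDecomposition U c ψ) (μ₁ : Fin D.N) (k₁ : Fin (D.r μ₁)) : H :=
  ((1 / Real.sqrt (Fintype.card G) : ℝ) : ℂ) •
    (((D.Δ μ₁ / D.β μ₁ k₁ : ℝ) : ℂ) • D.ξ μ₁ k₁
      - ∑ μ, if μ = μ₁ then 0 else ∑ k, ((Real.sqrt (D.d μ) : ℝ) : ℂ) • D.ξ μ k)

end SchmidtDecomposition

end StateExclusion

end

/-! Let S = √(Ω/|G|), with eigenvalues β_i. Since Ω commutes with every U_g, so does every f(S), and
evaluating Tr(f(S) Ω) along the orbit gives ⟨ψ|f(S)|ψ⟩ = ∑ f(β_i) β_i² (`inner_specFun`). Restricted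
to functions of S, both programs become scalar problems about the β_i, and no representation theory
is needed for the optimal value.

Primal point: E = |f(S)ψ⟩⟨f(S)ψ| with √|G| f equal to Δ/β₁² at β₁ and -1/x elsewhere. Its orbit sums
to |G| f(S)² S², so completeness amounts to Δ/β₁ ≤ 1. The zero-error condition is Δ - Δ = 0, and
Tr(ΩE) = Δ² + ∑_{i≥2} β_i² = 1 - (β₁² - Δ²).

Dual points: X = g(S) with g = ε at β₁ and x² + Δx elsewhere, so Tr X = 1 - β₁² + Δ² + ε.
Feasibility is Cauchy-Schwarz with weights β_i off the top eigenvector (`sq_sum_erase_le`), followed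
by completing a square (`quadratic_form_nonneg`), with ν of order 1/ε. Weak duality
(`dualValue_le_inconclusiveProb`) is proved against arbitrary families, so letting ε tend to 0
settles the general and the covariant program together.

Schmidt picture: Schur's lemma makes the product basis an eigenbasis of Ω (`ensembleOp_e`). Since β₁
is a simple eigenvalue, its irreducible summand is one-dimensional, and the explicit seed is exactly
f(S)ψ (`seed_eq`). -/

namespace StateExclusion

/-! ### Rank-one operators, unitary conjugation and traces -/

section Operators

variable {H : Type*} [NormedAddCommGroup H] [InnerProductSpace ℂ H]

theorem ketbra_apply (x y z : H) : ketbra x y z = inner ℂ y z • x := rfl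

theorem isPositive_ketbra_self (x : H) : (ketbra x x).IsPositive :=
  InnerProductSpace.isPositive_rankOne_self x

theorem unitaryConj_apply (V : H ≃ₗᵢ[ℂ] H) (E : H →ₗ[ℂ] H) (x : H) :
    unitaryConj V E x = V (E (V.symm x)) := rfl

theorem unitaryConj_add (V : H ≃ₗᵢ[ℂ] H) (A B : H →ₗ[ℂ] H) :
    unitaryConj V (A + B) = unitaryConj V A + unitaryConj V B := by
  ext x; simp [unitaryConj_apply]

theorem unitaryConj_sub (V : H ≃ₗᵢ[ℂ] H) (A B : H →ₗ[ℂ] H) :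
    unitaryConj V (A - B) = unitaryConj V A - unitaryConj V B := by
  ext x; simp [unitaryConj_apply]

theorem unitaryConj_smul (V : H ≃ₗᵢ[ℂ] H) (a : ℂ) (A : H →ₗ[ℂ] H) :
    unitaryConj V (a • A) = a • unitaryConj V A := by
  ext x; simp [unitaryConj_apply]

theorem unitaryConj_sum {ι : Type*} (s : Finset ι) (V : H ≃ₗᵢ[ℂ] H) (A : ι → H →ₗ[ℂ] H) :
    unitaryConj V (∑ i ∈ s, A i) = ∑ i ∈ s, unitaryConj V (A i) := by
  ext x; simp [unitaryConj_apply]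

theorem unitaryConj_ketbra (V : H ≃ₗᵢ[ℂ] H) (x y : H) :
    unitaryConj V (ketbra x y) = ketbra (V x) (V y) := by
  ext z
  rw [unitaryConj_apply, ketbra_apply, ketbra_apply, map_smul,
    ← V.inner_map_map y, V.apply_symm_apply]

theorem isPositive_unitaryConj (V : H ≃ₗᵢ[ℂ] H) {E : H →ₗ[ℂ] H} (hE : E.IsPositive) :
    (unitaryConj V E).IsPositive :=
  (LinearMap.isPositive_linearIsometryEquiv_conj_iff V).2 hE

theorem inner_unitaryConj (V : H ≃ₗᵢ[ℂ] H) (E : H →ₗ[ℂ] H) (x y : H) :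
    inner ℂ (V x) (unitaryConj V E (V y)) = inner ℂ x (E y) := by
  simp [unitaryConj_apply]

theorem reTrace_unitaryConj (V : H ≃ₗᵢ[ℂ] H) (E : H →ₗ[ℂ] H) :
    reTrace (unitaryConj V E) = reTrace E :=
  congrArg Complex.re (LinearMap.trace_conj' E V.toLinearEquiv)

theorem reTrace_add (A B : H →ₗ[ℂ] H) : reTrace (A + B) = reTrace A + reTrace B := by
  simp [reTrace]

theorem reTrace_sub (A B : H →ₗ[ℂ] H) : reTrace (A - B) = reTrace A - reTrace B := by
  simp [reTrace]

theorem reTrace_sum {ι : Type*} (s : Finset ι) (A : ι → H →ₗ[ℂ] H) :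
    reTrace (∑ i ∈ s, A i) = ∑ i ∈ s, reTrace (A i) := by
  simp [reTrace]

theorem reTrace_comp_unitaryConj (V : H ≃ₗᵢ[ℂ] H) (A B : H →ₗ[ℂ] H) :
    reTrace (unitaryConj V A ∘ₗ unitaryConj V B) = reTrace (A ∘ₗ B) := by
  rw [← reTrace_unitaryConj V (A ∘ₗ B)]
  congr 1
  ext x
  simp [unitaryConj_apply]

theorem reTrace_comp_sum {ι : Type*} (s : Finset ι) (B : H →ₗ[ℂ] H) (A : ι → H →ₗ[ℂ] H) :
    reTrace (B ∘ₗ ∑ i ∈ s, A i) = ∑ i ∈ s, reTrace (B ∘ₗ A i) := by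
  simp only [← Module.End.mul_eq_comp, Finset.mul_sum, reTrace_sum]

theorem reTrace_sum_comp {ι : Type*} (s : Finset ι) (A : ι → H →ₗ[ℂ] H) (B : H →ₗ[ℂ] H) :
    reTrace ((∑ i ∈ s, A i) ∘ₗ B) = ∑ i ∈ s, reTrace (A i ∘ₗ B) := by
  simp only [← Module.End.mul_eq_comp, Finset.sum_mul, reTrace_sum]

variable [FiniteDimensional ℂ H]

theorem reTrace_comp_comm (A B : H →ₗ[ℂ] H) : reTrace (A ∘ₗ B) = reTrace (B ∘ₗ A) := 
  congrArg Complex.re (LinearMap.trace_comp_comm' B A)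

theorem trace_comp_ketbra (A : H →ₗ[ℂ] H) (x y : H) :
    LinearMap.trace ℂ H (A ∘ₗ ketbra x y) = inner ℂ y (A x) := by
  have : A ∘ₗ ketbra x y = ketbra (A x) y := by
    ext z; simp [ketbra_apply]
  rw [this]
  exact InnerProductSpace.trace_rankOne _ _

theorem reTrace_comp_ketbra (A : H →ₗ[ℂ] H) (x y : H) :
    reTrace (A ∘ₗ ketbra x y) = (inner ℂ y (A x)).re := by
  rw [reTrace, trace_comp_ketbra]

theorem eq_sum_ketbra {A : H →ₗ[ℂ] H} (hA : A.IsSymmetric) :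
    A = ∑ i, ((hA.eigenvalues rfl i : ℝ) : ℂ) •
      ketbra (hA.eigenvectorBasis rfl i) (hA.eigenvectorBasis rfl i) := by
  refine (hA.eigenvectorBasis rfl).toBasis.ext fun j => ?_
  simp [ketbra_apply, OrthonormalBasis.inner_eq_ite]

/-- Expanding B in its eigenbasis turns the trace into a combination of numbers ⟨b_i|A|b_i⟩ ≥ 0 with
the nonnegative eigenvalues as coefficients. -/
theorem reTrace_comp_nonneg {A B : H →ₗ[ℂ] H} (hA : A.IsPositive) (hB : B.IsPositive) :
    0 ≤ reTrace (A ∘ₗ B) := by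
  rw [eq_sum_ketbra hB.isSymmetric, reTrace_comp_sum]
  refine Finset.sum_nonneg fun i _ => ?_
  rw [LinearMap.comp_smul, reTrace, map_smul, trace_comp_ketbra, smul_eq_mul,
    Complex.re_ofReal_mul]
  exact mul_nonneg (hB.nonneg_eigenvalues rfl i) (hA.re_inner_nonneg_right _)

end Operators

/-! ### The ensemble operator and group averages -/

section Ensemble

variable {G : Type*} [Fintype G] {H : Type*} [NormedAddCommGroup H] [InnerProductSpace ℂ H]

theorem ensembleOp_eq_average (U : G → H ≃ₗᵢ[ℂ] H) (ψ : H) :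
    ensembleOp U ψ = ∑ g, unitaryConj (U g) (ketbra ψ ψ) := by
  simp only [unitaryConj_ketbra, ensembleOp]

theorem isPositive_ensembleOp (U : G → H ≃ₗᵢ[ℂ] H) (ψ : H) : (ensembleOp U ψ).IsPositive :=
  LinearMap.isPositive_sum _ fun _ _ => isPositive_ketbra_self _

theorem isPositive_average (U : G → H ≃ₗᵢ[ℂ] H) {X : H →ₗ[ℂ] H} (hX : X.IsPositive) :
    (∑ g, unitaryConj (U g) X).IsPositive :=
  LinearMap.isPositive_sum _ fun _ _ => isPositive_unitaryConj _ hX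

theorem reTrace_average (U : G → H ≃ₗᵢ[ℂ] H) (X : H →ₗ[ℂ] H) :
    reTrace (∑ g, unitaryConj (U g) X) = Fintype.card G * reTrace X := by
  simp [reTrace_sum, reTrace_unitaryConj]

theorem PrimalFeasible.isUnambiguousExclusion {U : G → H ≃ₗᵢ[ℂ] H} {ψ : H}
    {E : H →ₗ[ℂ] H} (hE : PrimalFeasible U ψ E) :
    IsUnambiguousExclusion U ψ fun g => unitaryConj (U g) E where
  pos g := isPositive_unitaryConj _ hE.pos
  compl_pos := hE.compl_pos
  no_error g := by rw [inner_unitaryConj, hE.no_error]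

theorem inconclusiveProb_eq [FiniteDimensional ℂ H] [Nonempty G] (U : G → H ≃ₗᵢ[ℂ] H) {ψ : H} (hψ : ‖ψ‖ = 1) (P : G → H →ₗ[ℂ] H) :
    inconclusiveProb U ψ P
      = 1 - (1 / (Fintype.card G : ℝ)) * reTrace ((∑ h, P h) ∘ₗ ensembleOp U ψ) := by
  have hG : (Fintype.card G : ℝ) ≠ 0 := by simp
  rw [ensembleOp, reTrace_comp_sum, inconclusiveProb, ← Finset.mul_sum]
  have : ∀ g, (inner ℂ (U g ψ) ((1 - ∑ h, P h : H →ₗ[ℂ] H) (U g ψ))).re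
      = 1 - reTrace ((∑ h, P h) ∘ₗ ketbra (U g ψ) (U g ψ)) := by
    intro g
    rw [reTrace_comp_ketbra, LinearMap.sub_apply, inner_sub_right, Complex.sub_re]
    simp [hψ, inner_sum]
  simp only [this, Finset.sum_sub_distrib, Finset.sum_const, Finset.card_univ, nsmul_eq_mul]
  field_simp

end Ensemble

/-! ### Covariance and weak duality -/

section Group

variable {G : Type*} [Group G] {H : Type*} [NormedAddCommGroup H] [InnerProductSpace ℂ H]
  {U : G → H ≃ₗᵢ[ℂ] H} {c : G → G → ℂ}

/-- The multiplier is a scalar, so it cancels under conjugation: projective representations act on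
operators as genuine ones. -/
theorem IsProjectiveUnitaryRep.unitaryConj_unitaryConj (hU : IsProjectiveUnitaryRep U c) (g h : G)
    (X : H →ₗ[ℂ] H) : unitaryConj (U g) (unitaryConj (U h) X) = unitaryConj (U (g * h)) X := by
  ext x
  obtain ⟨y, rfl⟩ : ∃ y, x = U g (U h y) := ⟨(U h).symm ((U g).symm x), by simp⟩
  have h1 : (U (g * h)).symm (U g (U h y)) = c g h • y := by
    rw [hU.map_mul, map_smul, LinearIsometryEquiv.symm_apply_apply]
  simp only [unitaryConj_apply, LinearIsometryEquiv.symm_apply_apply, h1]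
  rw [hU.map_mul, map_smul, map_smul]

variable [Fintype G]

theorem IsProjectiveUnitaryRep.unitaryConj_average (hU : IsProjectiveUnitaryRep U c) (g : G)
    (X : H →ₗ[ℂ] H) :
    unitaryConj (U g) (∑ h, unitaryConj (U h) X) = ∑ h, unitaryConj (U h) X := by
  rw [unitaryConj_sum]
  simp only [hU.unitaryConj_unitaryConj]
  exact Fintype.sum_equiv (Equiv.mulLeft g) _ _ fun _ => rfl

theorem IsProjectiveUnitaryRep.unitaryConj_ensembleOp (hU : IsProjectiveUnitaryRep U c) (g : G)
    (ψ : H) : unitaryConj (U g) (ensembleOp U ψ) = ensembleOp U ψ := by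
  rw [ensembleOp_eq_average, hU.unitaryConj_average]

theorem IsProjectiveUnitaryRep.ensembleOp_commute (hU : IsProjectiveUnitaryRep U c) (g : G)
    (ψ x : H) : ensembleOp U ψ (U g x) = U g (ensembleOp U ψ x) := by
  conv_lhs => rw [← hU.unitaryConj_ensembleOp g ψ]
  simp [unitaryConj_apply]

variable [FiniteDimensional ℂ H]

theorem IsProjectiveUnitaryRep.inconclusiveProb_covariant (hU : IsProjectiveUnitaryRep U c) {ψ : H}
    (hψ : ‖ψ‖ = 1) (E : H →ₗ[ℂ] H) :
    inconclusiveProb U ψ (fun g => unitaryConj (U g) E) = primalValue U ψ E := by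
  have hG : (Fintype.card G : ℝ) ≠ 0 := by simp
  have : ∀ g, reTrace (unitaryConj (U g) E ∘ₗ ensembleOp U ψ) = reTrace (ensembleOp U ψ ∘ₗ E) := by
    intro g
    conv_lhs => rw [← hU.unitaryConj_ensembleOp g ψ]
    rw [reTrace_comp_unitaryConj, reTrace_comp_comm]
  rw [inconclusiveProb_eq U hψ, primalValue, reTrace_sum_comp]
  simp only [this, Finset.sum_const, Finset.card_univ, nsmul_eq_mul]
  field_simp

/-- Weak duality, without symmetrizing P: the dual constraint conjugated by U_g is paired with `P
g`. The averaged X and Ω are invariant, while the ν term becomes ν|ψ_g⟩⟨ψ_g| and is killed by the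
zero-error condition. -/
theorem IsProjectiveUnitaryRep.dualValue_le_inconclusiveProb (hU : IsProjectiveUnitaryRep U c)
    {ψ : H} (hψ : ‖ψ‖ = 1) {P : G → H →ₗ[ℂ] H} (hP : IsUnambiguousExclusion U ψ P)
    {X : H →ₗ[ℂ] H} {ν : ℝ} (hX : DualFeasible U ψ X ν) :
    dualValue X ≤ inconclusiveProb U ψ P := by
  have hG : (0 : ℝ) < Fintype.card G := by exact_mod_cast Fintype.card_pos
  set Y := ∑ g, unitaryConj (U g) X with hY
  have h1 : ∀ g, reTrace (P g ∘ₗ ensembleOp U ψ) ≤ reTrace (P g ∘ₗ Y) := by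
    intro g
    have h := reTrace_comp_nonneg (hP.pos g) (isPositive_unitaryConj (U g) hX.constraint)
    rw [unitaryConj_sub, unitaryConj_add, unitaryConj_smul, unitaryConj_ketbra,
      hU.unitaryConj_average, hU.unitaryConj_ensembleOp, LinearMap.comp_sub, LinearMap.comp_add,
      LinearMap.comp_smul, reTrace_sub, reTrace_add] at h
    have h0 : reTrace ((ν : ℂ) • P g ∘ₗ ketbra (U g ψ) (U g ψ)) = 0 := by
      rw [reTrace, map_smul, trace_comp_ketbra, hP.no_error]; simp
    rw [h0] at h
    linarith
  have h2 : reTrace ((∑ g, P g) ∘ₗ ensembleOp U ψ) ≤ reTrace ((∑ g, P g) ∘ₗ Y) := by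
    rw [reTrace_sum_comp, reTrace_sum_comp]
    exact Finset.sum_le_sum fun g _ => h1 g
  -- Positivity of the inconclusive element bounds Tr((∑ P g) Y) by Tr Y = |G| Tr X.
  have h3 := reTrace_comp_nonneg hP.compl_pos (isPositive_average U hX.pos)
  rw [← hY, LinearMap.sub_comp, reTrace_sub] at h3
  have h4 : reTrace ((1 : H →ₗ[ℂ] H) ∘ₗ Y) = Fintype.card G * reTrace X := by
    rw [← reTrace_average U X]; rfl
  rw [inconclusiveProb_eq U hψ, dualValue]
  have h5 : (1 / (Fintype.card G : ℝ)) * reTrace ((∑ h, P h) ∘ₗ ensembleOp U ψ) ≤ reTrace X := by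
    rw [one_div_mul_eq_div, div_le_iff₀ hG]
    linarith
  linarith

end Group

/-! ### Functional calculus of √(Ω/|G|) -/

section Calculus

variable {G : Type*} [Group G] [Fintype G] {H : Type*} [NormedAddCommGroup H]
  [InnerProductSpace ℂ H] [FiniteDimensional ℂ H]

/-- An orthonormal eigenbasis of the ensemble operator. -/
noncomputable def specBasis (U : G → H ≃ₗᵢ[ℂ] H) (ψ : H) :
    OrthonormalBasis (Fin (finrank ℂ H)) ℂ H :=
  (ensembleOp_isSymmetric U ψ).eigenvectorBasis rfl

/-- Functional calculus of `√(Ω / |G|)`. -/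
noncomputable def specFun (U : G → H ≃ₗᵢ[ℂ] H) (ψ : H) (f : ℝ → ℝ) : H →ₗ[ℂ] H :=
  ∑ i, (f (specBeta U ψ i) : ℂ) • ketbra (specBasis U ψ i) (specBasis U ψ i)

theorem specBeta_nonneg (U : G → H ≃ₗᵢ[ℂ] H) (ψ : H) (i : Fin (finrank ℂ H)) :
    0 ≤ specBeta U ψ i := Real.sqrt_nonneg _

theorem ensembleOp_specBasis (U : G → H ≃ₗᵢ[ℂ] H) (ψ : H)
    (i : Fin (finrank ℂ H)) :
    ensembleOp U ψ (specBasis U ψ i) =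
      ((Fintype.card G * specBeta U ψ i ^ 2 : ℝ) : ℂ) • specBasis U ψ i := by
  have hG : (Fintype.card G : ℝ) ≠ 0 := by simp
  rw [specBeta, Real.sq_sqrt (div_nonneg ((isPositive_ensembleOp U ψ).nonneg_eigenvalues rfl i)
    (Nat.cast_nonneg _)), mul_div_cancel₀ _ hG]
  exact (ensembleOp_isSymmetric U ψ).apply_eigenvectorBasis rfl i

theorem specFun_specBasis (U : G → H ≃ₗᵢ[ℂ] H) (ψ : H) (f : ℝ → ℝ) (i : Fin (finrank ℂ H)) :
    specFun U ψ f (specBasis U ψ i) = (f (specBeta U ψ i) : ℂ) • specBasis U ψ i := by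
  simp [specFun, ketbra_apply, OrthonormalBasis.inner_eq_ite]

theorem linearMap_ext_specBasis {U : G → H ≃ₗᵢ[ℂ] H} {ψ : H} {A B : H →ₗ[ℂ] H}
    (h : ∀ i, A (specBasis U ψ i) = B (specBasis U ψ i)) : A = B :=
  (specBasis U ψ).toBasis.ext fun i => by simpa using h i

theorem specFun_congr {U : G → H ≃ₗᵢ[ℂ] H} {ψ : H} {f g : ℝ → ℝ}
    (h : ∀ i, f (specBeta U ψ i) = g (specBeta U ψ i)) : specFun U ψ f = specFun U ψ g :=
  linearMap_ext_specBasis fun i => by rw [specFun_specBasis, specFun_specBasis, h]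

theorem specFun_comp (U : G → H ≃ₗᵢ[ℂ] H) (ψ : H) (f g : ℝ → ℝ) :
    specFun U ψ f ∘ₗ specFun U ψ g = specFun U ψ fun x => f x * g x :=
  linearMap_ext_specBasis (U := U) (ψ := ψ) fun i => by
    simp [specFun_specBasis, smul_smul, mul_comm, -Complex.coe_smul]

theorem specFun_sub (U : G → H ≃ₗᵢ[ℂ] H) (ψ : H) (f g : ℝ → ℝ) :
    specFun U ψ f - specFun U ψ g = specFun U ψ fun x => f x - g x :=
  linearMap_ext_specBasis (U := U) (ψ := ψ) fun i => by
    simp [specFun_specBasis, sub_smul]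

theorem specFun_const_smul (U : G → H ≃ₗᵢ[ℂ] H) (ψ : H) (a : ℝ) (f : ℝ → ℝ) :
    (a : ℂ) • specFun U ψ f = specFun U ψ fun x => a * f x :=
  linearMap_ext_specBasis (U := U) (ψ := ψ) fun i => by
    simp [specFun_specBasis, smul_smul, -Complex.coe_smul]

theorem specFun_one (U : G → H ≃ₗᵢ[ℂ] H) (ψ : H) : specFun U ψ (fun _ => 1) = 1 :=
  linearMap_ext_specBasis (U := U) (ψ := ψ) fun i => by simp [specFun_specBasis]

theorem ensembleOp_eq_specFun (U : G → H ≃ₗᵢ[ℂ] H) (ψ : H) :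
    ensembleOp U ψ = specFun U ψ fun x => Fintype.card G * x ^ 2 :=
  linearMap_ext_specBasis fun i => by rw [ensembleOp_specBasis, specFun_specBasis]

theorem specFun_isSymmetric (U : G → H ≃ₗᵢ[ℂ] H) (ψ : H) (f : ℝ → ℝ) :
    (specFun U ψ f).IsSymmetric :=
  LinearMap.isSymmetric_sum _ fun _ _ =>
    (isPositive_ketbra_self _).isSymmetric.smul (Complex.conj_ofReal _)

theorem inner_specFun_self (U : G → H ≃ₗᵢ[ℂ] H) (ψ : H) (f : ℝ → ℝ) (v : H) :
    inner ℂ v (specFun U ψ f v) =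
      ((∑ i, f (specBeta U ψ i) * ‖inner ℂ (specBasis U ψ i) v‖ ^ 2 : ℝ) : ℂ) := by
  simp only [specFun, LinearMap.sum_apply, LinearMap.smul_apply, ketbra_apply, inner_sum,
    inner_smul_right]
  push_cast
  refine Finset.sum_congr rfl fun i _ => ?_
  rw [← inner_conj_symm v, Complex.mul_conj']

theorem specFun_isPositive (U : G → H ≃ₗᵢ[ℂ] H) (ψ : H) {f : ℝ → ℝ}
    (hf : ∀ i, 0 ≤ f (specBeta U ψ i)) : (specFun U ψ f).IsPositive :=
  LinearMap.isPositive_sum _ fun i _ =>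
    (isPositive_ketbra_self _).smul_of_nonneg (Complex.zero_le_real.2 (hf i))

theorem trace_specFun (U : G → H ≃ₗᵢ[ℂ] H) (ψ : H) (f : ℝ → ℝ) :
    LinearMap.trace ℂ H (specFun U ψ f) = ((∑ i, f (specBeta U ψ i) : ℝ) : ℂ) := by
  simp [LinearMap.trace_eq_sum_inner _ (specBasis U ψ), specFun_specBasis, inner_smul_right, -Complex.coe_smul]

theorem reTrace_specFun (U : G → H ≃ₗᵢ[ℂ] H) (ψ : H) (f : ℝ → ℝ) :
    reTrace (specFun U ψ f) = ∑ i, f (specBeta U ψ i) := by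
  rw [reTrace, trace_specFun, Complex.ofReal_re]

/-- Eigenvectors of a symmetric operator for different eigenvalues are orthogonal; nonnegativity
lets β be recovered from β². -/
theorem specBeta_eq_of_inner_ne_zero {U : G → H ≃ₗᵢ[ℂ] H} {ψ v : H} {β : ℝ}
    (hβ : 0 ≤ β) (hv : ensembleOp U ψ v = ((Fintype.card G * β ^ 2 : ℝ) : ℂ) • v)
    {i : Fin (finrank ℂ H)} (hi : inner ℂ (specBasis U ψ i) v ≠ 0) : specBeta U ψ i = β := by
  have hG : (Fintype.card G : ℝ) ≠ 0 := by simp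
  have h := ensembleOp_isSymmetric U ψ (specBasis U ψ i) v
  rw [hv, ensembleOp_specBasis, inner_smul_left, inner_smul_right, Complex.conj_ofReal] at h
  have h1 := mul_left_cancel₀ hG (Complex.ofReal_injective (mul_right_cancel₀ hi h))
  exact (sq_eq_sq₀ (specBeta_nonneg U ψ i) hβ).1 h1

/-- Shows that `specFun` does not depend on the chosen eigenbasis. It is needed for the vectors U_g
b_i and for the Schmidt basis, which need not belong to that eigenbasis. -/
theorem specFun_apply_of_eigenvector {U : G → H ≃ₗᵢ[ℂ] H} {ψ v : H} {β : ℝ}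
    (hβ : 0 ≤ β) (hv : ensembleOp U ψ v = ((Fintype.card G * β ^ 2 : ℝ) : ℂ) • v) (f : ℝ → ℝ) :
    specFun U ψ f v = (f β : ℂ) • v := by
  refine (specBasis U ψ).repr.injective (PiLp.ext fun i => ?_)
  rw [OrthonormalBasis.repr_apply_apply, OrthonormalBasis.repr_apply_apply, ← specFun_isSymmetric,
    specFun_specBasis, inner_smul_left, inner_smul_right, Complex.conj_ofReal]
  by_cases h0 : inner ℂ (specBasis U ψ i) v = 0
  · simp [h0]
  · rw [specBeta_eq_of_inner_ne_zero hβ hv h0]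

theorem sum_specBeta [Nontrivial H] (U : G → H ≃ₗᵢ[ℂ] H) (ψ : H) (f : ℝ → ℝ) :
    ∑ i, f (specBeta U ψ i) = f (specTop U ψ) +
      ∑ i : Fin (finrank ℂ H), if (i : ℕ) = 0 then 0 else f (specBeta U ψ i) := by
  have : ∀ i : Fin (finrank ℂ H), f (specBeta U ψ i)
      = (if i = ⟨0, finrank_pos⟩ then f (specTop U ψ) else 0)
        + if (i : ℕ) = 0 then 0 else f (specBeta U ψ i) := by
    intro i
    by_cases h : (i : ℕ) = 0
    · obtain rfl : i = ⟨0, finrank_pos⟩ := Fin.ext h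
      simp [specTop]
    · simp [h, Fin.ext_iff]
  rw [Finset.sum_congr rfl fun i _ => this i, Finset.sum_add_distrib]
  simp

theorem specBeta_le_specTop [Nontrivial H] (U : G → H ≃ₗᵢ[ℂ] H) (ψ : H)
    (i : Fin (finrank ℂ H)) : specBeta U ψ i ≤ specTop U ψ :=
  Real.sqrt_le_sqrt (div_le_div_of_nonneg_right
    ((ensembleOp_isSymmetric U ψ).eigenvalues_antitone rfl (Fin.mk_le_mk.2 (Nat.zero_le _)))
    (Nat.cast_nonneg _))

theorem specDelta_nonneg (U : G → H ≃ₗᵢ[ℂ] H) (ψ : H) : 0 ≤ specDelta U ψ :=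
  Finset.sum_nonneg fun i _ => by split_ifs; exacts [le_rfl, specBeta_nonneg U ψ i]

theorem specBeta_le_specDelta (U : G → H ≃ₗᵢ[ℂ] H) (ψ : H) {i : Fin (finrank ℂ H)}
    (hi : (i : ℕ) ≠ 0) : specBeta U ψ i ≤ specDelta U ψ := by
  have := Finset.single_le_sum (f := fun i : Fin (finrank ℂ H) =>
    if (i : ℕ) = 0 then 0 else specBeta U ψ i)
    (fun j _ => by split_ifs; exacts [le_rfl, specBeta_nonneg U ψ j])
    (Finset.mem_univ i)
  simpa [hi, specDelta] using this

/-- Every other β_i is at most Δ < β₁, so the top eigenvalue is simple and a spectral function may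
be given its own value there. -/
theorem specBeta_eq_specTop_iff [Nontrivial H] {U : G → H ≃ₗᵢ[ℂ] H} {ψ : H}
    (h : specDelta U ψ < specTop U ψ) (i : Fin (finrank ℂ H)) :
    specBeta U ψ i = specTop U ψ ↔ (i : ℕ) = 0 := by
  refine ⟨fun hi => ?_, fun hi => by rw [specTop]; congr 1; exact Fin.ext hi⟩
  by_contra h0
  linarith [specBeta_le_specDelta U ψ h0]

/-- Sum of a function over the spectrum, with a separate value at the (simple) top. -/
theorem sum_specBeta_ite [Nontrivial H] {U : G → H ≃ₗᵢ[ℂ] H} {ψ : H}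
    (h : specDelta U ψ < specTop U ψ) (a : ℝ) (f : ℝ → ℝ) :
    (∑ i, if specBeta U ψ i = specTop U ψ then a else f (specBeta U ψ i)) =
      a + ((∑ i, f (specBeta U ψ i)) - f (specTop U ψ)) := by
  rw [sum_specBeta U ψ f, sum_specBeta U ψ fun x => if x = specTop U ψ then a else f x,
    if_pos rfl, add_sub_cancel_left]
  congr 1
  refine Finset.sum_congr rfl fun i _ => ?_
  by_cases hi : (i : ℕ) = 0
  · simp [hi]
  · simp [hi, specBeta_eq_specTop_iff h]

theorem sum_specBeta_id [Nontrivial H] (U : G → H ≃ₗᵢ[ℂ] H) (ψ : H) :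
    ∑ i, specBeta U ψ i = specTop U ψ + specDelta U ψ := sum_specBeta U ψ id

end Calculus

/-! ### Spectral weights of the fiducial state -/

section Covariance

variable {G : Type*} [Group G] [Fintype G] {H : Type*} [NormedAddCommGroup H]
  [InnerProductSpace ℂ H] [FiniteDimensional ℂ H] {U : G → H ≃ₗᵢ[ℂ] H} {c : G → G → ℂ}

theorem IsProjectiveUnitaryRep.specFun_commute (hU : IsProjectiveUnitaryRep U c) (g : G)
    (ψ : H) (f : ℝ → ℝ) (x : H) : specFun U ψ f (U g x) = U g (specFun U ψ f x) := by
  suffices h : specFun U ψ f ∘ₗ (U g).toLinearEquiv.toLinearMap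
      = (U g).toLinearEquiv.toLinearMap ∘ₗ specFun U ψ f from LinearMap.congr_fun h x
  refine linearMap_ext_specBasis (U := U) (ψ := ψ) fun i => ?_
  have h : ensembleOp U ψ (U g (specBasis U ψ i)) =
      ((Fintype.card G * specBeta U ψ i ^ 2 : ℝ) : ℂ) • U g (specBasis U ψ i) := by
    rw [hU.ensembleOp_commute, ensembleOp_specBasis, map_smul]
  have h2 := specFun_apply_of_eigenvector (specBeta_nonneg U ψ i) h f
  simp [specFun_specBasis, h2, -Complex.coe_smul]

theorem IsProjectiveUnitaryRep.unitaryConj_specFun (hU : IsProjectiveUnitaryRep U c) (g : G)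
    (ψ : H) (f : ℝ → ℝ) : unitaryConj (U g) (specFun U ψ f) = specFun U ψ f := by
  ext x
  rw [unitaryConj_apply, ← hU.specFun_commute, LinearIsometryEquiv.apply_symm_apply]

/-- Since f(S) commutes with the U_g, all |G| orbit terms of Tr(f(S) Ω) equal ⟨ψ|f(S)|ψ⟩; the same
trace is also the spectral sum of f times |G| x². -/
theorem IsProjectiveUnitaryRep.inner_specFun (hU : IsProjectiveUnitaryRep U c)
    (ψ : H) (f : ℝ → ℝ) : inner ℂ ψ (specFun U ψ f ψ) =
      ((∑ i, f (specBeta U ψ i) * specBeta U ψ i ^ 2 : ℝ) : ℂ) := by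
  have hG : (Fintype.card G : ℂ) ≠ 0 := by simp
  have h1 : LinearMap.trace ℂ H (specFun U ψ f ∘ₗ ensembleOp U ψ)
      = Fintype.card G * inner ℂ ψ (specFun U ψ f ψ) := by
    rw [ensembleOp, ← Module.End.mul_eq_comp, Finset.mul_sum, map_sum]
    simp [Module.End.mul_eq_comp, trace_comp_ketbra, hU.specFun_commute]
  rw [ensembleOp_eq_specFun, specFun_comp, trace_specFun] at h1
  refine mul_left_cancel₀ hG (h1.symm.trans ?_)
  push_cast
  rw [Finset.mul_sum]
  exact Finset.sum_congr rfl fun i _ => by ring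

/-- The orbit of `F(f) ψ` averages to `|G| F(f² x²)`. -/
theorem IsProjectiveUnitaryRep.average_ketbra_specFun (hU : IsProjectiveUnitaryRep U c)
    (ψ : H) (f : ℝ → ℝ) :
    ∑ g, unitaryConj (U g) (ketbra (specFun U ψ f ψ) (specFun U ψ f ψ)) =
      specFun U ψ fun x => Fintype.card G * (f x ^ 2 * x ^ 2) := by
  have h : ∑ g, unitaryConj (U g) (ketbra (specFun U ψ f ψ) (specFun U ψ f ψ)) =
      specFun U ψ f ∘ₗ ensembleOp U ψ ∘ₗ specFun U ψ f := by
    ext x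
    simp only [LinearMap.sum_apply, unitaryConj_ketbra, LinearMap.comp_apply, ensembleOp, map_sum,
      ketbra_apply, map_smul, ← hU.specFun_commute]
    exact Finset.sum_congr rfl fun g _ => by rw [specFun_isSymmetric]
  rw [h, ensembleOp_eq_specFun, specFun_comp, specFun_comp]
  exact specFun_congr fun i => by ring

theorem IsProjectiveUnitaryRep.sum_specBeta_sq (hU : IsProjectiveUnitaryRep U c)
    {ψ : H} (hψ : ‖ψ‖ = 1) : ∑ i, specBeta U ψ i ^ 2 = 1 := by
  have h := hU.inner_specFun ψ fun _ => 1
  rw [specFun_one, Module.End.one_apply, inner_self_eq_norm_sq_to_K, hψ, RCLike.ofReal_one] at h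
  simp only [one_pow, one_mul] at h
  exact_mod_cast h.symm

/-- Inside a degenerate eigenspace the individual weights |⟨b_i|ψ⟩|² may differ from β_i²; only
their totals agree. Taking f to be an indicator isolates one eigenspace. -/
theorem IsProjectiveUnitaryRep.sum_normSq_specBasis (hU : IsProjectiveUnitaryRep U c)
    (ψ : H) (f : ℝ → ℝ) : ∑ i, f (specBeta U ψ i) * ‖inner ℂ (specBasis U ψ i) ψ‖ ^ 2 =
      ∑ i, f (specBeta U ψ i) * specBeta U ψ i ^ 2 :=
  Complex.ofReal_injective ((inner_specFun_self U ψ f ψ).symm.trans (hU.inner_specFun ψ f))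

theorem IsProjectiveUnitaryRep.inner_specBasis_eq_zero (hU : IsProjectiveUnitaryRep U c)
    {ψ : H}
    {i : Fin (finrank ℂ H)} (hi : specBeta U ψ i = 0) : inner ℂ (specBasis U ψ i) ψ = 0 := by
  have h := hU.sum_normSq_specBasis ψ fun x => if x = 0 then 1 else 0
  have h2 : ∑ i, (if specBeta U ψ i = 0 then (1 : ℝ) else 0) * specBeta U ψ i ^ 2 = 0 :=
    Finset.sum_eq_zero fun i _ => by split_ifs with h0 <;> simp [h0]
  rw [h2, Finset.sum_eq_zero_iff_of_nonneg fun i _ => by positivity] at h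
  simpa [hi] using h i (Finset.mem_univ i)

end Covariance

/-! ### The optimal primal point and near-optimal dual points -/

section Optimality

variable {G : Type*} [Group G] [Fintype G] {H : Type*} [NormedAddCommGroup H]
  [InnerProductSpace ℂ H] [FiniteDimensional ℂ H] [Nontrivial H]

/-- The spectral function of the optimal seed: `Δ / β₁²` at `β₁` and `-x⁻¹` elsewhere, divided by
`√|G|`. -/
noncomputable def seedFun (U : G → H ≃ₗᵢ[ℂ] H) (ψ : H) (x : ℝ) : ℝ :=
  1 / √(Fintype.card G) * if x = specTop U ψ then specDelta U ψ / specTop U ψ ^ 2 else -x⁻¹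

variable {U : G → H ≃ₗᵢ[ℂ] H} {c : G → G → ℂ} {ψ : H}

theorem specTop_pos (hregion : specDelta U ψ < specTop U ψ) : 0 < specTop U ψ :=
  (specDelta_nonneg U ψ).trans_lt hregion

theorem card_mul_seedFun_sq (U : G → H ≃ₗᵢ[ℂ] H) (ψ : H) (x : ℝ) :
    Fintype.card G * seedFun U ψ x ^ 2 =
      (if x = specTop U ψ then specDelta U ψ / specTop U ψ ^ 2 else -x⁻¹) ^ 2 := by
  have hG : (Fintype.card G : ℝ) ≠ 0 := by simp
  rw [seedFun, mul_pow, div_pow, Real.sq_sqrt (Nat.cast_nonneg _), one_pow, ← mul_assoc,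
    mul_one_div_cancel hG, one_mul]

theorem IsProjectiveUnitaryRep.primalFeasible_seedFun (hU : IsProjectiveUnitaryRep U c)
    (hregion : specDelta U ψ < specTop U ψ) :
    PrimalFeasible U ψ
      (ketbra (specFun U ψ (seedFun U ψ) ψ) (specFun U ψ (seedFun U ψ) ψ)) where
  pos := isPositive_ketbra_self _
  compl_pos := by
    have hb := specTop_pos hregion
    rw [hU.average_ketbra_specFun, ← specFun_one U ψ, specFun_sub]
    refine specFun_isPositive U ψ fun i => ?_
    rw [← mul_assoc, card_mul_seedFun_sq]
    split_ifs with h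
    · rw [h, sub_nonneg]
      have h1 : (specDelta U ψ / specTop U ψ ^ 2) ^ 2 * specTop U ψ ^ 2
          = (specDelta U ψ / specTop U ψ) ^ 2 := by field_simp
      rw [h1]
      exact pow_le_one₀ (div_nonneg (specDelta_nonneg U ψ) hb.le)
        ((div_le_one hb).2 hregion.le)
    -- On the kernel of Ω the convention 0⁻¹ = 0 leaves the inconclusive element equal to 1; on the
    -- rest of the non-top spectrum it is 0.
    · by_cases h0 : specBeta U ψ i = 0
      · simp [h0]
      · have : (-(specBeta U ψ i)⁻¹) ^ 2 * specBeta U ψ i ^ 2 = 1 := by field_simp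
        rw [this, sub_self]
  no_error := by
    have hb := specTop_pos hregion
    rw [ketbra_apply, inner_smul_right, hU.inner_specFun]
    -- The weighted sum is Δ at the top and -β_i elsewhere, so it cancels to zero.
    have h1 : ∀ i, seedFun U ψ (specBeta U ψ i) * specBeta U ψ i ^ 2 =
        1 / √(Fintype.card G) *
          if specBeta U ψ i = specTop U ψ then specDelta U ψ else -specBeta U ψ i := by
      intro i
      rw [seedFun, mul_assoc]
      congr 1
      split_ifs with h
      · rw [h]; field_simp
      · by_cases h0 : specBeta U ψ i = 0
        · simp [h0]
        · field_simp
    rw [Finset.sum_congr rfl fun i _ => h1 i, ← Finset.mul_sum,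
      sum_specBeta_ite hregion _ fun x => -x, Finset.sum_neg_distrib, sum_specBeta_id]
    simp

theorem IsProjectiveUnitaryRep.primalValue_seedFun (hU : IsProjectiveUnitaryRep U c)
    (hψ : ‖ψ‖ = 1) (hregion : specDelta U ψ < specTop U ψ) :
    primalValue U ψ
      (ketbra (specFun U ψ (seedFun U ψ) ψ) (specFun U ψ (seedFun U ψ) ψ)) = Qprim U ψ := by
  have hb := specTop_pos hregion
  rw [primalValue, reTrace_comp_ketbra, ensembleOp_eq_specFun, ← LinearMap.comp_apply,
    specFun_comp, specFun_isSymmetric, ← LinearMap.comp_apply, specFun_comp, hU.inner_specFun,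
    Complex.ofReal_re]
  have h1 : ∀ i, seedFun U ψ (specBeta U ψ i) * (Fintype.card G * specBeta U ψ i ^ 2 *
      seedFun U ψ (specBeta U ψ i)) * specBeta U ψ i ^ 2 =
        if specBeta U ψ i = specTop U ψ then specDelta U ψ ^ 2 else specBeta U ψ i ^ 2 := by
    intro i
    have h2 := card_mul_seedFun_sq U ψ (specBeta U ψ i)
    calc _ = (Fintype.card G * seedFun U ψ (specBeta U ψ i) ^ 2) * specBeta U ψ i ^ 4 := by ring
      _ = _ := by
        rw [h2]
        split_ifs with h
        · rw [h]; field_simp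
        · by_cases h0 : specBeta U ψ i = 0
          · simp [h0]
          · field_simp
  rw [Finset.sum_congr rfl fun i _ => h1 i, sum_specBeta_ite hregion _ fun x => x ^ 2,
    hU.sum_specBeta_sq hψ, Qprim]
  ring

/-- The spectral function of the near-optimal dual points. -/
noncomputable def dualFun (U : G → H ≃ₗᵢ[ℂ] H) (ψ : H) (ε x : ℝ) : ℝ :=
  if x = specTop U ψ then ε else x ^ 2 + specDelta U ψ * x

theorem IsProjectiveUnitaryRep.dualValue_dualFun (hU : IsProjectiveUnitaryRep U c)
    (hψ : ‖ψ‖ = 1) (hregion : specDelta U ψ < specTop U ψ) (ε : ℝ) :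
    dualValue (specFun U ψ (dualFun U ψ ε)) = Qprim U ψ - ε := by
  rw [dualValue, reTrace_specFun]
  simp only [dualFun]
  rw [sum_specBeta_ite hregion ε fun x => x ^ 2 + specDelta U ψ * x, Finset.sum_add_distrib,
    ← Finset.mul_sum, hU.sum_specBeta_sq hψ, sum_specBeta_id, Qprim]
  ring

theorem IsProjectiveUnitaryRep.norm_inner_specBasis_top (hU : IsProjectiveUnitaryRep U c)
    (hregion : specDelta U ψ < specTop U ψ) :
    ‖inner ℂ (specBasis U ψ ⟨0, finrank_pos⟩) ψ‖ ^ 2 = specTop U ψ ^ 2 := by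
  have h := hU.sum_normSq_specBasis ψ fun x => if x = specTop U ψ then 1 else 0
  have h2 : ∀ (i : Fin (finrank ℂ H)), (i : ℕ) = 0 ↔ i = ⟨0, finrank_pos⟩ := fun i => by
    rw [Fin.ext_iff]
  simp only [specBeta_eq_specTop_iff hregion, h2, ite_mul, one_mul, zero_mul, Finset.sum_ite_eq',
    Finset.mem_univ, if_true] at h
  exact h

/-- Cauchy-Schwarz away from the top eigenvector. -/
theorem IsProjectiveUnitaryRep.sq_sum_erase_le (hU : IsProjectiveUnitaryRep U c)
    (hregion : specDelta U ψ < specTop U ψ) (v : H) :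
    ‖∑ i ∈ Finset.univ.erase (⟨0, finrank_pos⟩ : Fin (finrank ℂ H)),
        inner ℂ ψ (specBasis U ψ i) * inner ℂ (specBasis U ψ i) v‖ ^ 2 ≤
      specDelta U ψ * ∑ i ∈ Finset.univ.erase (⟨0, finrank_pos⟩ : Fin (finrank ℂ H)),
        specBeta U ψ i * ‖inner ℂ (specBasis U ψ i) v‖ ^ 2 := by
  set s := Finset.univ.erase (⟨0, finrank_pos⟩ : Fin (finrank ℂ H)) with hs
  have hne : ∀ i ∈ s, (i : ℕ) ≠ 0 := fun i hi h => Finset.ne_of_mem_erase hi (Fin.ext h)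
  -- The weight x⁻¹ off the top gives ∑_{i≥2} |⟨b_i|ψ⟩|²/β_i = Δ, which is the Cauchy-Schwarz
  -- constant.
  have h := hU.sum_normSq_specBasis ψ fun x => if x = specTop U ψ then 0 else x⁻¹
  rw [← Finset.add_sum_erase _ _ (Finset.mem_univ (⟨0, finrank_pos⟩ : Fin (finrank ℂ H))), ← hs,
    if_pos ((specBeta_eq_specTop_iff hregion _).2 rfl), zero_mul, zero_add] at h
  have hr : ∑ i, (if specBeta U ψ i = specTop U ψ then 0 else (specBeta U ψ i)⁻¹)
      * specBeta U ψ i ^ 2 = specDelta U ψ := by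
    refine Finset.sum_congr rfl fun i _ => ?_
    simp only [specBeta_eq_specTop_iff hregion]
    split_ifs with h0
    · simp
    · by_cases h1 : specBeta U ψ i = 0
      · simp [h1]
      · field_simp
  have hl : ∑ i ∈ s, (if specBeta U ψ i = specTop U ψ then 0 else (specBeta U ψ i)⁻¹)
      * ‖inner ℂ (specBasis U ψ i) ψ‖ ^ 2 =
      ∑ i ∈ s, (specBeta U ψ i)⁻¹ * ‖inner ℂ (specBasis U ψ i) ψ‖ ^ 2 :=
    Finset.sum_congr rfl fun i hi => by
      rw [if_neg ((specBeta_eq_specTop_iff hregion i).not.2 (hne i hi))]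
  rw [hr, hl] at h
  rw [← h]
  refine (pow_le_pow_left₀ (norm_nonneg _) (norm_sum_le _ _) 2).trans ?_
  refine Finset.sum_sq_le_sum_mul_sum_of_sq_le_mul s
    (fun i _ => mul_nonneg (inv_nonneg.2 (specBeta_nonneg U ψ i)) (sq_nonneg _))
    (fun i _ => mul_nonneg (specBeta_nonneg U ψ i) (sq_nonneg _)) fun i _ => le_of_eq ?_
  rw [norm_mul, norm_inner_symm ψ]
  -- When β_i = 0 the factor β_i⁻¹ is useless, but ψ has no component there.
  by_cases h0 : specBeta U ψ i = 0
  · simp [hU.inner_specBasis_eq_zero h0]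
  · field_simp

/-- Here σ, τ, ρ stand for |⟨ψ|v⟩| and the moduli of its top and remaining parts. Replacing ρ by |σ
- τ| leaves σ² plus a perfect square; the coefficient b²/ε is the one that completes it. -/
theorem quadratic_form_nonneg {b ε τ σ ρ v : ℝ} (hb : 0 < b) (hε : 0 < ε)
    (h1 : τ ≤ σ + ρ) (h2 : σ ≤ τ + ρ) (hv : τ ^ 2 = b ^ 2 * v ^ 2) :
    0 ≤ (ε - b ^ 2) * v ^ 2 + ρ ^ 2 + b ^ 2 / ε * σ ^ 2 := by
  have h3 : (σ - τ) ^ 2 ≤ ρ ^ 2 := sq_le_sq' (by linarith) (by linarith)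
  have h4 : (ε - b ^ 2) * v ^ 2 + (σ - τ) ^ 2 + b ^ 2 / ε * σ ^ 2
      = σ ^ 2 + (ε * τ - b ^ 2 * σ) ^ 2 / (ε * b ^ 2) := by
    have : v ^ 2 = τ ^ 2 / b ^ 2 := by rw [hv]; field_simp
    rw [this]
    field_simp
    ring
  have h5 : 0 ≤ σ ^ 2 + (ε * τ - b ^ 2 * σ) ^ 2 / (ε * b ^ 2) := by positivity
  linarith

theorem IsProjectiveUnitaryRep.dualFeasible_dualFun (hU : IsProjectiveUnitaryRep U c)
    (hregion : specDelta U ψ < specTop U ψ) {ε : ℝ} (hε : 0 < ε) :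
    DualFeasible U ψ (specFun U ψ (dualFun U ψ ε))
      (Fintype.card G * (specTop U ψ ^ 2 / ε)) where
  pos := specFun_isPositive U ψ fun i => by
    have := specBeta_nonneg U ψ i
    have := specDelta_nonneg U ψ
    rw [dualFun]
    split_ifs <;> positivity
  constraint := by
    have hb := specTop_pos hregion
    have hsum : ∑ g, unitaryConj (U g) (specFun U ψ (dualFun U ψ ε)) =
        specFun U ψ fun x => Fintype.card G * dualFun U ψ ε x := by
      simp only [hU.unitaryConj_specFun, Finset.sum_const, Finset.card_univ,
        ← specFun_const_smul]
      rw [← Nat.cast_smul_eq_nsmul ℂ]; norm_cast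
    -- What remains is |G| times (ε - β₁²) on the top vector and Δβ_i elsewhere, plus ν|ψ⟩⟨ψ|; only
    -- the top coefficient can be negative.
    rw [hsum, ensembleOp_eq_specFun, add_sub_right_comm, specFun_sub]
    refine ⟨(specFun_isSymmetric _ _ _).add
      ((isPositive_ketbra_self ψ).isSymmetric.smul (Complex.conj_ofReal _)), fun v => ?_⟩
    rw [inner_re_symm, LinearMap.add_apply, inner_add_right, inner_specFun_self,
      LinearMap.smul_apply, ketbra_apply, inner_smul_right, inner_smul_right,
      ← inner_conj_symm v ψ, Complex.mul_conj', map_add]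
    norm_cast
    simp only [RCLike.re_to_complex, Complex.ofReal_re]
    set i₀ : Fin (finrank ℂ H) := ⟨0, finrank_pos⟩ with hi₀
    have htop : specBeta U ψ i₀ = specTop U ψ := rfl
    have hsplit : ∑ i, (Fintype.card G * dualFun U ψ ε (specBeta U ψ i)
          - Fintype.card G * specBeta U ψ i ^ 2) * ‖inner ℂ (specBasis U ψ i) v‖ ^ 2
        = Fintype.card G * ((ε - specTop U ψ ^ 2) * ‖inner ℂ (specBasis U ψ i₀) v‖ ^ 2 +
          specDelta U ψ * ∑ i ∈ Finset.univ.erase i₀,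
            specBeta U ψ i * ‖inner ℂ (specBasis U ψ i) v‖ ^ 2) := by
      rw [← Finset.add_sum_erase _ _ (Finset.mem_univ i₀), mul_add, Finset.mul_sum,
        Finset.mul_sum]
      congr 1
      · rw [htop, dualFun, if_pos rfl]; ring
      · refine Finset.sum_congr rfl fun i hi => ?_
        rw [dualFun, if_neg ((specBeta_eq_specTop_iff hregion i).not.2
          fun h => Finset.ne_of_mem_erase hi (Fin.ext h))]
        ring
    have hinner : inner ℂ ψ v = inner ℂ ψ (specBasis U ψ i₀) * inner ℂ (specBasis U ψ i₀) v +
        ∑ i ∈ Finset.univ.erase i₀,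
          inner ℂ ψ (specBasis U ψ i) * inner ℂ (specBasis U ψ i) v := by
      rw [Finset.add_sum_erase _ (fun i => inner ℂ ψ (specBasis U ψ i) *
        inner ℂ (specBasis U ψ i) v) (Finset.mem_univ i₀), OrthonormalBasis.sum_inner_mul_inner]
    set t := inner ℂ ψ (specBasis U ψ i₀) * inner ℂ (specBasis U ψ i₀) v with ht
    have hcs := hU.sq_sum_erase_le hregion v
    set r := ∑ i ∈ Finset.univ.erase i₀,
      inner ℂ ψ (specBasis U ψ i) * inner ℂ (specBasis U ψ i) v with hr
    have h1 : ‖t‖ ≤ ‖inner ℂ ψ v‖ + ‖r‖ := by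
      rw [show t = inner ℂ ψ v - r by rw [hinner]; ring]
      exact norm_sub_le _ _
    have h2 : ‖inner ℂ ψ v‖ ≤ ‖t‖ + ‖r‖ := by
      rw [hinner]
      exact norm_add_le _ _
    have h3 : ‖t‖ ^ 2 = specTop U ψ ^ 2 * ‖inner ℂ (specBasis U ψ i₀) v‖ ^ 2 := by
      rw [ht, norm_mul, mul_pow, norm_inner_symm, hU.norm_inner_specBasis_top hregion]
    have h4 := quadratic_form_nonneg hb hε h1 h2 h3
    rw [hsplit, mul_assoc (Fintype.card G : ℝ), ← mul_add]
    exact mul_nonneg (Nat.cast_nonneg _) (by linarith)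

end Optimality

/-! ### Schur's lemma for families of matrices -/

section Schur

variable {ι : Type*} {m n : Type*} [Fintype m] [Fintype n]

/-- Schur's lemma: an intertwiner between irreducible families of matrices vanishes or is
bijective. -/
theorem intertwiner_eq_zero_or_bijective {A : ι → Matrix m m ℂ} {B : ι → Matrix n n ℂ}
    (hA : ∀ S : Submodule ℂ (m → ℂ), (∀ g, ∀ x ∈ S, (A g).mulVec x ∈ S) → S = ⊥ ∨ S = ⊤)
    (hB : ∀ S : Submodule ℂ (n → ℂ), (∀ g, ∀ x ∈ S, (B g).mulVec x ∈ S) → S = ⊥ ∨ S = ⊤)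
    (T : (m → ℂ) →ₗ[ℂ] (n → ℂ)) (hT : ∀ g x, T ((A g).mulVec x) = (B g).mulVec (T x)) :
    T = 0 ∨ Function.Bijective T := by
  rcases hA (LinearMap.ker T) fun g x hx => by
    rw [LinearMap.mem_ker] at hx ⊢; rw [hT, hx, Matrix.mulVec_zero] with h | h
  · rcases hB (LinearMap.range T) (by rintro g _ ⟨x, rfl⟩; exact ⟨_, hT g x⟩) with h' | h'
    · exact Or.inl (LinearMap.range_eq_bot.1 h')
    · exact Or.inr ⟨LinearMap.ker_eq_bot.1 h, LinearMap.range_eq_top.1 h'⟩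
  · exact Or.inl (LinearMap.ker_eq_top.1 h)

/-- Over ℂ, T has an eigenvalue z; T - z is an intertwiner with nonzero kernel, hence zero. -/
theorem intertwiner_eq_smul_id [Nonempty m] {A : ι → Matrix m m ℂ}
    (hA : ∀ S : Submodule ℂ (m → ℂ), (∀ g, ∀ x ∈ S, (A g).mulVec x ∈ S) → S = ⊥ ∨ S = ⊤)
    (T : (m → ℂ) →ₗ[ℂ] (m → ℂ)) (hT : ∀ g x, T ((A g).mulVec x) = (A g).mulVec (T x)) :
    ∃ z : ℂ, T = z • LinearMap.id := by
  obtain ⟨z, hz⟩ := Module.End.exists_eigenvalue T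
  obtain ⟨x, hx⟩ := hz.exists_hasEigenvector
  refine ⟨z, sub_eq_zero.1 ((intertwiner_eq_zero_or_bijective hA hA (T - z • LinearMap.id)
    fun g y => ?_).resolve_right fun h => hx.2 (h.1 ?_))⟩
  · simp [hT, Matrix.mulVec_sub, Matrix.mulVec_smul]
  · simp [hx.apply_eq_smul]

end Schur

/-! ### The ensemble operator in the Schmidt basis -/

namespace SchmidtDecomposition

variable {G : Type*} [Group G] {H : Type*} [NormedAddCommGroup H]
  [InnerProductSpace ℂ H] {U : G → H ≃ₗᵢ[ℂ] H} {c : G → G → ℂ} {ψ : H}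
  (D : SchmidtDecomposition U c ψ)

/-- Schmidt coefficients, extended by zero to the whole multiplicity space. -/
noncomputable def coeff (μ : Fin D.N) (j : Fin (D.m μ)) : ℝ :=
  if h : (j : ℕ) < D.r μ then D.β μ ⟨j, h⟩ else 0

theorem coeff_nonneg (μ : Fin D.N) (j : Fin (D.m μ)) : 0 ≤ D.coeff μ j := by
  rw [coeff]; split_ifs; exacts [(D.β_pos _ _).le, le_rfl]

theorem coeff_castLE (μ : Fin D.N) (k : Fin (D.r μ)) :
    D.coeff μ (Fin.castLE (D.r_le_m μ) k) = D.β μ k := by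
  simp [coeff]

theorem sum_coeff (μ : Fin D.N) : ∑ j, D.coeff μ j = ∑ k, D.β μ k := by
  rw [← Finset.sum_subset (Finset.subset_univ (Finset.univ.map (Fin.castLEEmb (D.r_le_m μ))))]
  · simp [coeff_castLE]
  · intro j _ hj
    rw [coeff, dif_neg fun h => hj (Finset.mem_map.2 ⟨⟨j, h⟩, Finset.mem_univ _, rfl⟩)]

/-- U acts trivially on the multiplicity index, so the coordinates with fixed j transform by W
alone. -/
theorem inner_e_map (g : G) (ν : Fin D.N) (i : Fin (D.d ν)) (j : Fin (D.m ν)) (y : H) :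
    inner ℂ (D.e ⟨ν, (i, j)⟩) (U g y) = ∑ k, D.W ν g i k * inner ℂ (D.e ⟨ν, (k, j)⟩) y := by
  suffices h : (innerSL ℂ (D.e ⟨ν, (i, j)⟩)).toLinearMap ∘ₗ (U g).toLinearEquiv.toLinearMap
      = ∑ k, D.W ν g i k • (innerSL ℂ (D.e ⟨ν, (k, j)⟩)).toLinearMap by
    simpa using LinearMap.congr_fun h y
  refine D.e.toBasis.ext fun ⟨μ, (i', j')⟩ => ?_
  simp only [OrthonormalBasis.coe_toBasis, LinearMap.comp_apply, LinearMap.sum_apply,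
    LinearMap.smul_apply, ContinuousLinearMap.coe_coe, innerSL_apply_apply,
    LinearEquiv.coe_coe, LinearIsometryEquiv.coe_toLinearEquiv, D.map_e, inner_sum,
    inner_smul_right, D.e.inner_eq_ite, smul_eq_mul]
  by_cases hμ : ν = μ
  · subst hμ
    by_cases hj : j = j'
    · subst hj; simp
    · simp [hj]
  · simp [hμ]

theorem inner_e_self (μ : Fin D.N) (i : Fin (D.d μ)) (j : Fin (D.m μ)) :
    inner ℂ (D.e ⟨μ, (i, j)⟩) ψ =
      if (i : ℕ) = j then ((√(D.d μ) * D.coeff μ j : ℝ) : ℂ) else 0 := by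
  refine (congrArg (inner ℂ (D.e ⟨μ, (i, j)⟩)) D.schmidt).trans ?_
  simp only [inner_sum, inner_smul_right, D.e.inner_eq_ite]
  rw [Finset.sum_eq_single μ (fun ν _ hν => Finset.sum_eq_zero fun k _ => by
    rw [if_neg fun h => hν (congrArg Sigma.fst h).symm, mul_zero]) (by simp)]
  by_cases hij : (i : ℕ) = j
  · rw [if_pos hij]
    by_cases hr : (j : ℕ) < D.r μ
    · rw [Finset.sum_eq_single ⟨j, hr⟩ _ (by simp)]
      · rw [if_pos, mul_one, coeff, dif_pos hr]
        congr 2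
        exact Fin.ext hij
      · intro k _ hk
        rw [if_neg, mul_zero]
        intro h
        simp only [Sigma.mk.injEq, heq_eq_eq, true_and, Prod.mk.injEq] at h
        exact hk (Fin.ext (by simp [h.2]))
    · rw [coeff, dif_neg hr, mul_zero, Complex.ofReal_zero]
      refine Finset.sum_eq_zero fun k _ => ?_
      rw [if_neg, mul_zero]
      intro h
      simp only [Sigma.mk.injEq, heq_eq_eq, true_and, Prod.mk.injEq] at h
      exact hr (by simp [h.2])
  · rw [if_neg hij]
    refine Finset.sum_eq_zero fun k _ => ?_
    rw [if_neg, mul_zero]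
    intro h
    simp only [Sigma.mk.injEq, heq_eq_eq, true_and, Prod.mk.injEq] at h
    exact hij (by simp [h.1, h.2])

theorem rank_eq_one {μ₁ : Fin D.N} (k₁ : Fin (D.r μ₁)) (hd : D.d μ₁ = 1) : D.r μ₁ = 1 :=
  le_antisymm (hd ▸ D.r_le_d μ₁) (Nat.zero_lt_of_lt k₁.2)

theorem sum_univ_of_rank_eq_one {M : Type*} [AddCommMonoid M] {μ₁ : Fin D.N} (hr : D.r μ₁ = 1)
    (k₁ : Fin (D.r μ₁)) (f : Fin (D.r μ₁) → M) : ∑ k, f k = f k₁ := by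
  have : Subsingleton (Fin (D.r μ₁)) := by rw [hr]; infer_instance
  exact Fintype.sum_subsingleton f k₁

/-- Keeps coefficients outside μ₁ strictly below β₁, so that the seed function takes its -x⁻¹ branch
on them. -/
theorem β_le_Δ {μ μ₁ : Fin D.N} (hμ : μ ≠ μ₁) (k : Fin (D.r μ)) : D.β μ k ≤ D.Δ μ₁ := by
  have hnn : ∀ (ν : Fin D.N) l, 0 ≤ (D.d ν : ℝ) * D.β ν l := fun ν l =>
    mul_nonneg (Nat.cast_nonneg _) (D.β_pos ν l).le
  have h1 : (1 : ℝ) ≤ D.d μ := Nat.one_le_cast.2 (D.d_pos μ)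
  calc D.β μ k ≤ D.d μ * D.β μ k := le_mul_of_one_le_left (D.β_pos μ k).le h1
    _ ≤ ∑ l, D.d μ * D.β μ l :=
      Finset.single_le_sum (f := fun l => (D.d μ : ℝ) * D.β μ l) (fun l _ => hnn μ l)
        (Finset.mem_univ k)
    _ = if μ = μ₁ then 0 else ∑ l, D.d μ * D.β μ l := (if_neg hμ).symm
    _ ≤ D.Δ μ₁ :=
      Finset.single_le_sum (f := fun ν => if ν = μ₁ then 0 else ∑ l, (D.d ν : ℝ) * D.β ν l)
        (fun ν _ => by
          split_ifs
          exacts [le_rfl, Finset.sum_nonneg fun l _ => hnn ν l]) (Finset.mem_univ μ)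

variable [Fintype G]

/-- Block of the ensemble operator between two irreducible summands. -/
noncomputable def block (μ ν : Fin D.N) (j : Fin (D.m μ)) (j' : Fin (D.m ν)) :
    Matrix (Fin (D.d ν)) (Fin (D.d μ)) ℂ :=
  fun i' i => inner ℂ (D.e ⟨ν, (i', j')⟩) (ensembleOp U ψ (D.e ⟨μ, (i, j)⟩))

theorem block_mul (hU : IsProjectiveUnitaryRep U c) (g : G) (μ ν : Fin D.N) (j : Fin (D.m μ))
    (j' : Fin (D.m ν)) : D.block μ ν j j' * D.W μ g = D.W ν g * D.block μ ν j j' := by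
  ext i' i
  have h := congrArg (inner ℂ (D.e ⟨ν, (i', j')⟩)) (hU.ensembleOp_commute g ψ (D.e ⟨μ, (i, j)⟩))
  rw [D.inner_e_map, D.map_e, map_sum, inner_sum] at h
  simp only [map_smul, inner_smul_right] at h
  rw [Matrix.mul_apply, Matrix.mul_apply]
  exact (Finset.sum_congr rfl fun k _ => mul_comm _ _).trans h

theorem toLin'_block_mulVec (hU : IsProjectiveUnitaryRep U c) (g : G) (μ ν : Fin D.N)
    (j : Fin (D.m μ)) (j' : Fin (D.m ν)) (x : Fin (D.d μ) → ℂ) :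
    Matrix.toLin' (D.block μ ν j j') ((D.W μ g).mulVec x)
      = (D.W ν g).mulVec (Matrix.toLin' (D.block μ ν j j') x) := by
  rw [Matrix.toLin'_apply, Matrix.toLin'_apply, Matrix.mulVec_mulVec, Matrix.mulVec_mulVec,
    D.block_mul hU]

theorem block_eq_zero (hU : IsProjectiveUnitaryRep U c) {μ ν : Fin D.N} (h : μ ≠ ν)
    (j : Fin (D.m μ)) (j' : Fin (D.m ν)) : D.block μ ν j j' = 0 := by
  rcases intertwiner_eq_zero_or_bijective (D.irreducible μ) (D.irreducible ν)
    (Matrix.toLin' (D.block μ ν j j')) (fun g => D.toLin'_block_mulVec hU g μ ν j j') with h0 | h0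
  · simpa using h0
  · exact (D.inequivalent μ ν h (LinearEquiv.ofBijective _ h0)
      fun g => D.toLin'_block_mulVec hU g μ ν j j').elim

/-- The trace is a sum over g of inner products of W_g a_j and W_g a_j', and unitarity makes every
term ⟨a_j, a_j'⟩. The Schmidt form leaves a_j at most one nonzero entry, √d_μ β_j in position j. -/
theorem trace_block (μ : Fin D.N) (j j' : Fin (D.m μ)) :
    (D.block μ μ j j').trace =
      if j = j' then ((D.d μ * (Fintype.card G * D.coeff μ j ^ 2) : ℝ) : ℂ) else 0 := by
  let a : Fin (D.m μ) → Fin (D.d μ) → ℂ := fun j i => inner ℂ (D.e ⟨μ, (i, j)⟩) ψ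
  have h1 : (D.block μ μ j j').trace = ∑ g, star ((D.W μ g).mulVec (a j)) ⬝ᵥ
      (D.W μ g).mulVec (a j') := by
    simp only [Matrix.trace, Matrix.diag, block, ensembleOp, LinearMap.sum_apply, inner_sum,
      ketbra_apply, inner_smul_right]
    rw [Finset.sum_comm]
    refine Finset.sum_congr rfl fun g _ => Finset.sum_congr rfl fun i _ => ?_
    rw [← inner_conj_symm, D.inner_e_map, D.inner_e_map]
    rfl
  have h2 : ∀ g, star ((D.W μ g).mulVec (a j)) ⬝ᵥ (D.W μ g).mulVec (a j') =
      star (a j) ⬝ᵥ a j' := by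
    intro g
    rw [Matrix.star_mulVec, Matrix.dotProduct_mulVec, Matrix.vecMul_vecMul,
      ← Matrix.star_eq_conjTranspose, Matrix.mem_unitaryGroup_iff'.1 (D.W_unitary μ g),
      Matrix.vecMul_one]
  have h3 : star (a j) ⬝ᵥ a j' = if j = j' then ((D.d μ * D.coeff μ j ^ 2 : ℝ) : ℂ) else 0 := by
    simp only [dotProduct, Pi.star_apply, a, D.inner_e_self]
    split_ifs with hj
    · subst hj
      by_cases hr : (j : ℕ) < D.r μ
      · rw [Finset.sum_eq_single (⟨j, hr.trans_le (D.r_le_d μ)⟩ : Fin (D.d μ)) _ (by simp)]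
        · rw [if_pos rfl, RCLike.star_def, Complex.conj_ofReal, ← Complex.ofReal_mul, ← sq,
            mul_pow, Real.sq_sqrt (Nat.cast_nonneg _)]
        · intro i _ hi
          rw [if_neg fun h => hi (Fin.ext h), mul_zero]
      · simp [coeff, hr]
    · refine Finset.sum_eq_zero fun i _ => ?_
      by_cases hi : (i : ℕ) = j
      · rw [if_neg (c := (i : ℕ) = j') fun h => hj (Fin.ext (hi.symm.trans h)), mul_zero]
      · rw [if_neg hi, star_zero, zero_mul]
  simp only [h1, h2, h3, Finset.sum_const, Finset.card_univ, nsmul_eq_mul]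
  split_ifs
  · push_cast; ring
  · simp

/-- Schur makes the block a scalar, and comparing traces fixes it: the d_μ from the identity cancels
the d_μ coming from the Schmidt normalization. -/
theorem block_self (hU : IsProjectiveUnitaryRep U c) (μ : Fin D.N) (j j' : Fin (D.m μ)) :
    D.block μ μ j j' =
      (if j = j' then ((Fintype.card G * D.coeff μ j ^ 2 : ℝ) : ℂ) else 0) • 1 := by
  have : Nonempty (Fin (D.d μ)) := ⟨⟨0, D.d_pos μ⟩⟩
  have hd : (D.d μ : ℂ) ≠ 0 := Nat.cast_ne_zero.2 (D.d_pos μ).ne'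
  obtain ⟨z, hz⟩ := intertwiner_eq_smul_id (D.irreducible μ) (Matrix.toLin' (D.block μ μ j j'))
    (fun g => D.toLin'_block_mulVec hU g μ μ j j')
  have hz' : D.block μ μ j j' = z • 1 :=
    Matrix.toLin'.injective (by rw [hz, map_smul, Matrix.toLin'_one])
  have ht := D.trace_block μ j j'
  rw [hz', Matrix.trace_smul, Matrix.trace_one, Fintype.card_fin, smul_eq_mul] at ht
  rw [hz']
  congr 1
  refine mul_right_cancel₀ hd (ht.trans ?_)
  split_ifs
  · push_cast; ring
  · simp

theorem ensembleOp_e (hU : IsProjectiveUnitaryRep U c) (μ : Fin D.N) (i : Fin (D.d μ))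
    (j : Fin (D.m μ)) : ensembleOp U ψ (D.e ⟨μ, (i, j)⟩) =
      ((Fintype.card G * D.coeff μ j ^ 2 : ℝ) : ℂ) • D.e ⟨μ, (i, j)⟩ := by
  refine D.e.repr.injective (PiLp.ext fun ⟨ν, (i', j')⟩ => ?_)
  rw [OrthonormalBasis.repr_apply_apply, OrthonormalBasis.repr_apply_apply, inner_smul_right,
    D.e.inner_eq_ite]
  change D.block μ ν j j' i' i = _
  by_cases hμ : μ = ν
  · subst hμ
    rw [D.block_self hU]
    by_cases hj : j = j'
    · subst hj
      simp [Matrix.one_apply]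
    · simp [hj, Ne.symm hj]
  · rw [D.block_eq_zero hU hμ, if_neg fun h => hμ (congrArg Sigma.fst h).symm]
    simp

variable [FiniteDimensional ℂ H]

theorem specFun_e (hU : IsProjectiveUnitaryRep U c) (f : ℝ → ℝ) (μ : Fin D.N) (i : Fin (D.d μ))
    (j : Fin (D.m μ)) :
    specFun U ψ f (D.e ⟨μ, (i, j)⟩) = (f (D.coeff μ j) : ℂ) • D.e ⟨μ, (i, j)⟩ :=
  specFun_apply_of_eigenvector (D.coeff_nonneg μ j) (D.ensembleOp_e hU μ i j) f

/-- Both sides are Tr √(Ω/|G|), computed in the Schmidt basis and in the spectral basis; d_μ counts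
the basis vectors sharing one coefficient. -/
theorem sum_dim_mul_β [Nontrivial H] (hU : IsProjectiveUnitaryRep U c) :
    ∑ μ, ∑ k, (D.d μ : ℝ) * D.β μ k = specTop U ψ + specDelta U ψ := by
  rw [← sum_specBeta_id]
  refine Complex.ofReal_injective ((Eq.symm ?_).trans (trace_specFun U ψ fun x => x))
  rw [LinearMap.trace_eq_sum_inner _ D.e, Fintype.sum_sigma, Complex.ofReal_sum]
  refine Finset.sum_congr rfl fun μ _ => ?_
  rw [Fintype.sum_prod_type]
  simp only [D.specFun_e hU, inner_smul_right, D.e.inner_eq_ite, if_true, mul_one]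
  rw [← Complex.ofReal_sum, D.sum_coeff, ← Finset.mul_sum]
  simp

/-! ### The top summand and the explicit seed -/

section Top

variable [Nontrivial H] {μ₁ : Fin D.N} {k₁ : Fin (D.r μ₁)}

theorem β_eq_specTop (hU : IsProjectiveUnitaryRep U c) (hmax : ∀ μ k, D.β μ k ≤ D.β μ₁ k₁) :
    D.β μ₁ k₁ = specTop U ψ := by
  refine le_antisymm ?_ ?_
  · obtain ⟨i, hi⟩ : ∃ i, inner ℂ (specBasis U ψ i) (D.ξ μ₁ k₁) ≠ 0 := by
      by_contra! h
      have h0 : D.ξ μ₁ k₁ = 0 := by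
        rw [← (specBasis U ψ).sum_repr' (D.ξ μ₁ k₁)]
        simp [h]
      exact D.e.orthonormal.ne_zero _ h0
    have h := specBeta_eq_of_inner_ne_zero (D.coeff_nonneg _ _) (D.ensembleOp_e hU _ _ _) hi
    rw [coeff_castLE] at h
    exact h ▸ specBeta_le_specTop U ψ i
  -- The top eigenvector overlaps some product vector, so β₁ is one of the extended coefficients.
  · obtain ⟨⟨μ, i, j⟩, hx⟩ :
        ∃ x, inner ℂ (D.e x) (specBasis U ψ ⟨0, finrank_pos⟩) ≠ 0 := by
      by_contra! h
      have h0 : specBasis U ψ ⟨0, finrank_pos⟩ = 0 := by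
        rw [← D.e.sum_repr' (specBasis U ψ ⟨0, finrank_pos⟩)]
        simp [h]
      exact (specBasis U ψ).orthonormal.ne_zero _ h0
    have h := specBeta_eq_of_inner_ne_zero (D.coeff_nonneg _ _) (D.ensembleOp_e hU _ _ _)
      (mt inner_eq_zero_symm.1 hx)
    change specTop U ψ = _ at h
    rw [h, coeff]
    split_ifs
    exacts [hmax _ _, (D.β_pos _ _).le]

/-- All d_μ₁ vectors sharing the top coefficient are multiples of the single top eigenvector; two of
them could not be orthogonal unit vectors. -/
theorem dim_eq_one (hU : IsProjectiveUnitaryRep U c)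
    (hregion : specDelta U ψ < specTop U ψ) (htop : D.β μ₁ k₁ = specTop U ψ) :
    D.d μ₁ = 1 := by
  set j := Fin.castLE (D.r_le_m μ₁) k₁
  have hinner : ∀ i n, n ≠ (⟨0, finrank_pos⟩ : Fin (finrank ℂ H)) →
      inner ℂ (specBasis U ψ n) (D.e ⟨μ₁, (i, j)⟩) = 0 := by
    intro i n hn
    by_contra h
    have h1 := specBeta_eq_of_inner_ne_zero (D.coeff_nonneg _ _) (D.ensembleOp_e hU _ _ _) h
    rw [coeff_castLE, htop, specBeta_eq_specTop_iff hregion] at h1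
    exact hn (Fin.ext h1)
  have hmul : ∀ i i', inner ℂ (D.e ⟨μ₁, (i, j)⟩) (D.e ⟨μ₁, (i', j)⟩) =
      inner ℂ (D.e ⟨μ₁, (i, j)⟩) (specBasis U ψ ⟨0, finrank_pos⟩) *
        inner ℂ (specBasis U ψ ⟨0, finrank_pos⟩) (D.e ⟨μ₁, (i', j)⟩) := by
    intro i i'
    rw [← (specBasis U ψ).sum_inner_mul_inner]
    exact Finset.sum_eq_single _ (fun n _ hn => by rw [hinner i' n hn, mul_zero]) (by simp)
  refine le_antisymm ?_ (D.d_pos μ₁)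
  by_contra! hd
  have h0 := hmul ⟨0, D.d_pos μ₁⟩ ⟨0, D.d_pos μ₁⟩
  have h1 := hmul ⟨1, hd⟩ ⟨1, hd⟩
  have h01 := hmul ⟨0, D.d_pos μ₁⟩ ⟨1, hd⟩
  simp only [D.e.inner_eq_ite, if_true] at h0 h1 h01
  rw [if_neg (by simp)] at h01
  rcases mul_eq_zero.1 h01.symm with h | h
  · rw [h, zero_mul] at h0; exact one_ne_zero h0
  · rw [h, mul_zero] at h1; exact one_ne_zero h1

theorem Δ_eq_specDelta (hU : IsProjectiveUnitaryRep U c) (hd : D.d μ₁ = 1)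
    (htop : D.β μ₁ k₁ = specTop U ψ) : D.Δ μ₁ = specDelta U ψ := by
  have h := D.sum_dim_mul_β hU
  have h1 : ∑ μ, ∑ k, (D.d μ : ℝ) * D.β μ k = ∑ k, (D.d μ₁ : ℝ) * D.β μ₁ k + D.Δ μ₁ := by
    rw [← Finset.add_sum_erase _ _ (Finset.mem_univ μ₁), Δ,
      ← Finset.add_sum_erase Finset.univ _ (Finset.mem_univ μ₁), if_pos rfl, zero_add]
    congr 1
    exact Finset.sum_congr rfl fun μ hμ => by rw [if_neg (Finset.ne_of_mem_erase hμ)]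
  rw [h1, D.sum_univ_of_rank_eq_one (D.rank_eq_one k₁ hd) k₁, hd, htop, Nat.cast_one,
    one_mul] at h
  linarith

theorem seed_eq (hU : IsProjectiveUnitaryRep U c) (hregion : specDelta U ψ < specTop U ψ)
    (hd : D.d μ₁ = 1) (htop : D.β μ₁ k₁ = specTop U ψ) :
    D.seed μ₁ k₁ = specFun U ψ (seedFun U ψ) ψ := by
  have hb := specTop_pos hregion
  have hΔ := D.Δ_eq_specDelta hU hd htop
  have hψ : specFun U ψ (seedFun U ψ) ψ = ∑ μ, ∑ k : Fin (D.r μ),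
      ((√(D.d μ) * D.β μ k * seedFun U ψ (D.β μ k) : ℝ) : ℂ) • D.ξ μ k := by
    refine (congrArg (specFun U ψ (seedFun U ψ)) D.schmidt).trans ?_
    simp only [map_sum, map_smul, D.specFun_e hU, coeff_castLE, smul_smul, ξ,
      ← Complex.ofReal_mul]
  rw [hψ, ← Finset.add_sum_erase _ _ (Finset.mem_univ μ₁),
    D.sum_univ_of_rank_eq_one (D.rank_eq_one k₁ hd) k₁, seed,
    ← Finset.add_sum_erase Finset.univ _ (Finset.mem_univ μ₁), if_pos rfl, zero_add, smul_sub,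
    smul_smul, sub_eq_add_neg, ← smul_neg, ← Finset.sum_neg_distrib, Finset.smul_sum]
  congr 1
  · rw [← Complex.ofReal_mul, hΔ, htop, hd, seedFun, if_pos rfl]
    congr 2
    rw [Nat.cast_one, Real.sqrt_one]
    field_simp
  · refine Finset.sum_congr rfl fun μ hμ => ?_
    have hne := Finset.ne_of_mem_erase hμ
    rw [if_neg hne, ← Finset.sum_neg_distrib, Finset.smul_sum]
    refine Finset.sum_congr rfl fun k _ => ?_
    have hβ : D.β μ k ≠ specTop U ψ := fun h => by
      have := D.β_le_Δ hne k
      linarith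
    have hβ0 := (D.β_pos μ k).ne'
    rw [← neg_smul, smul_smul, ← Complex.ofReal_neg, ← Complex.ofReal_mul, seedFun, if_neg hβ]
    congr 2
    field_simp

end Top

end SchmidtDecomposition

theorem IsProjectiveUnitaryRep.dualValue_le_Qprim {G : Type*} [Group G] [Fintype G]
    {H : Type*} [NormedAddCommGroup H] [InnerProductSpace ℂ H] [FiniteDimensional ℂ H]
    [Nontrivial H] {U : G → H ≃ₗᵢ[ℂ] H} {c : G → G → ℂ} {ψ : H}
    (hU : IsProjectiveUnitaryRep U c) (hψ : ‖ψ‖ = 1) (hregion : specDelta U ψ < specTop U ψ)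
    {X : H →ₗ[ℂ] H} {ν : ℝ} (hX : DualFeasible U ψ X ν) : dualValue X ≤ Qprim U ψ := by
  -- The optimal seed serves as the primal witness for weak duality.
  rw [← hU.primalValue_seedFun hψ hregion, ← hU.inconclusiveProb_covariant hψ]
  exact hU.dualValue_le_inconclusiveProb hψ
    (hU.primalFeasible_seedFun hregion).isUnambiguousExclusion hX

theorem IsProjectiveUnitaryRep.Qprim_le_inconclusiveProb {G : Type*} [Group G] [Fintype G]
    {H : Type*} [NormedAddCommGroup H] [InnerProductSpace ℂ H] [FiniteDimensional ℂ H]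
    [Nontrivial H] {U : G → H ≃ₗᵢ[ℂ] H} {c : G → G → ℂ} {ψ : H}
    (hU : IsProjectiveUnitaryRep U c) (hψ : ‖ψ‖ = 1) (hregion : specDelta U ψ < specTop U ψ)
    {P : G → H →ₗ[ℂ] H} (hP : IsUnambiguousExclusion U ψ P) :
    Qprim U ψ ≤ inconclusiveProb U ψ P := by
  -- The dual points used reach the optimum only up to ε, with ν growing like 1/ε, hence the
  -- limiting argument.
  refine le_of_forall_pos_le_add fun ε hε => ?_
  have h := hU.dualValue_le_inconclusiveProb hψ hP (hU.dualFeasible_dualFun hregion hε)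
  rw [hU.dualValue_dualFun hψ hregion] at h
  linarith

end StateExclusion

theorem mainTheorem3 {G : Type*} [Group G] [Fintype G]
    {H : Type*} [NormedAddCommGroup H] [InnerProductSpace ℂ H] [FiniteDimensional ℂ H]
    [Nontrivial H]
    (U : G → H ≃ₗᵢ[ℂ] H) (c : G → G → ℂ) (hU : StateExclusion.IsProjectiveUnitaryRep U c)
    (ψ : H) (hψ : ‖ψ‖ = 1)
    -- outside the region of perfect exclusion
    (hregion : StateExclusion.specDelta U ψ < StateExclusion.specTop U ψ) :
    -- optimal value over all unambiguous exclusion measurements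
    IsLeast {q : ℝ | ∃ P : G → H →ₗ[ℂ] H,
        StateExclusion.IsUnambiguousExclusion U ψ P ∧
          q = StateExclusion.inconclusiveProb U ψ P}
      (StateExclusion.Qprim U ψ) ∧
    -- optimal value of the covariant primal program
    IsLeast {q : ℝ | ∃ E : H →ₗ[ℂ] H,
        StateExclusion.PrimalFeasible U ψ E ∧ q = StateExclusion.primalValue U ψ E}
      (StateExclusion.Qprim U ψ) ∧
    -- the dual program has no gap
    (∀ (X : H →ₗ[ℂ] H) (ν : ℝ), StateExclusion.DualFeasible U ψ X ν →
      StateExclusion.dualValue X ≤ StateExclusion.Qprim U ψ) ∧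
    (∀ ε : ℝ, 0 < ε → ∃ (X : H →ₗ[ℂ] H) (ν : ℝ), StateExclusion.DualFeasible U ψ X ν ∧
      StateExclusion.dualValue X = StateExclusion.Qprim U ψ - ε) ∧
    -- in the irreducible (Schmidt) picture, the covariant seed attains the optimum
    (∀ (D : StateExclusion.SchmidtDecomposition U c ψ),
      (∀ (μ : Fin D.N) (i : Fin (D.d μ)) (k : Fin (D.r μ)),
        StateExclusion.ensembleOp U ψ (D.e ⟨μ, (i, Fin.castLE (D.r_le_m μ) k)⟩) =
          (((Fintype.card G : ℝ) * D.β μ k ^ 2 : ℝ) : ℂ) •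
            D.e ⟨μ, (i, Fin.castLE (D.r_le_m μ) k)⟩) ∧
      ∀ (μ₁ : Fin D.N) (k₁ : Fin (D.r μ₁)), (∀ μ k, D.β μ k ≤ D.β μ₁ k₁) →
        D.d μ₁ = 1 ∧ D.r μ₁ = 1 ∧
        D.β μ₁ k₁ = StateExclusion.specTop U ψ ∧
        D.Δ μ₁ = StateExclusion.specDelta U ψ ∧
        StateExclusion.Qprim U ψ = D.β μ₁ k₁ ^ 2 - D.Δ μ₁ ^ 2 ∧
        StateExclusion.PrimalFeasible U ψ
          (StateExclusion.ketbra (D.seed μ₁ k₁) (D.seed μ₁ k₁)) ∧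
        StateExclusion.primalValue U ψ
          (StateExclusion.ketbra (D.seed μ₁ k₁) (D.seed μ₁ k₁)) = StateExclusion.Qprim U ψ ∧
        StateExclusion.IsUnambiguousExclusion U ψ
          (fun g => StateExclusion.unitaryConj (U g)
            (StateExclusion.ketbra (D.seed μ₁ k₁) (D.seed μ₁ k₁))) ∧
        StateExclusion.inconclusiveProb U ψ
          (fun g => StateExclusion.unitaryConj (U g)
            (StateExclusion.ketbra (D.seed μ₁ k₁) (D.seed μ₁ k₁))) =
          StateExclusion.Qprim U ψ) := by
  have hfeas := hU.primalFeasible_seedFun hregion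
  have hval := hU.primalValue_seedFun hψ hregion
  have hprob := hU.inconclusiveProb_covariant hψ
    (StateExclusion.ketbra (StateExclusion.specFun U ψ (StateExclusion.seedFun U ψ) ψ)
      (StateExclusion.specFun U ψ (StateExclusion.seedFun U ψ) ψ))
  refine ⟨⟨⟨_, hfeas.isUnambiguousExclusion, (hprob.trans hval).symm⟩, ?_⟩,
    ⟨⟨_, hfeas, hval.symm⟩, ?_⟩, fun X ν hX => hU.dualValue_le_Qprim hψ hregion hX,
    fun ε hε => ⟨_, _, hU.dualFeasible_dualFun hregion hε, hU.dualValue_dualFun hψ hregion ε⟩,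
    fun D => ⟨fun μ i k => ?_, fun μ₁ k₁ hmax => ?_⟩⟩
  · rintro _ ⟨P, hP, rfl⟩
    exact hU.Qprim_le_inconclusiveProb hψ hregion hP
  · rintro _ ⟨E, hE, rfl⟩
    rw [← hU.inconclusiveProb_covariant hψ]
    exact hU.Qprim_le_inconclusiveProb hψ hregion hE.isUnambiguousExclusion
  · rw [D.ensembleOp_e hU, D.coeff_castLE]
  · have htop := D.β_eq_specTop hU hmax
    have hd := D.dim_eq_one hU hregion htop
    have hΔ := D.Δ_eq_specDelta hU hd htop
    rw [D.seed_eq hU hregion hd htop]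
    exact ⟨hd, D.rank_eq_one k₁ hd, htop, hΔ, by rw [htop, hΔ]; rfl, hfeas, hval,
      hfeas.isUnambiguousExclusion, hprob.trans hval⟩
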